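/- Let $f(x)=x-\log(1+x)$ for $x>-1$, and let $$c_n=\frac{1}{2\,n!}\left[\frac{\mathrm d^n}{\mathrm dx^n}\left(\frac{x^2}{x-\log(1+x)}\right)^{(n+1)/2}\right]_{x=0},\qquad \gamma_n=(-1)^n\sqrt{\tfrac{2}{\pi}}\;\Gamma\!\left(n+\tfrac12\right)c_{2n}\qquad(n\ge 0),$$ where the quotient is given its limit value $2$ at $x=0$. For $\lambda>0$, $\lambda\neq1$, put $\mu=\lambda-1$, let $\eta$ be the real number with $\tfrac12\eta^2=\lambda-\log\lambda-1$ and the same sign as $\lambda-1$, and let $$C_n(\eta)=(-1)^n\left(\frac{1}{2^{2n+1/2}\,n!}\left[\frac{\mathrm d^{2n}}{\mathrm dx^{2n}}\left\{\frac{1}{\mu-x}\left(\frac{x^2}{x-\log(1+x)}\right)^{n+1/2}\right\}\right]_{x=0}-\frac{2^n\,\Gamma(n+\frac12)}{\sqrt\pi\,\eta^{2n+1}}\right)$$ be the coefficients of Temme's uniform asymptotic expansion of the normalized incomplete gamma function $\Gamma(a,\lambda a)/\Gamma(a)$, where $\Gamma(a,x)=\int_x^\infty e^{-t}t^{a-1}\,\mathrm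 dt$. Here $\sim$ denotes a Poincaré asymptotic expansion (the remainder after any number of terms is $O$ of the first omitted scale function). Then: (a) the $c_n$ are the coefficients in Laplace's method for $f(x)=x-\log(1+x)$, $g\equiv1$, that is, as $\lambda\to+\infty$, $$\int_0^{\infty}e^{-\lambda(x-\log(1+x))}\,\mathrm dx\sim\sum_{n=0}^\infty\Gamma\!\left(\tfrac{n+1}{2}\right)\frac{c_n}{\lambda^{(n+1)/2}};$$ (b) the $\gamma_n$ are the Stirling coefficients, that is, as $\lambda\to+\infty$, $$\Gamma(\lambda)\sim\sqrt{2\pi}\,\lambda^{\lambda-1/2}e^{-\lambda}\sum_{n=0}^\infty(-1)^n\frac{\gamma_n}{\lambda^n};$$ (c) as $a\to+\infty$ through real values, $$\frac{\Gamma(a,a)}{\Gamma(a)}\sim\frac12+\frac{1}{\sqrt{2\pi a}}\sum_{n=0}^\infty\frac{C_n(0)}{a^n}$$ holds with $$C_n(0)=-\frac13\gamma_n+\sum_{k=0}^{n-1}(n-k)!\,\gamma_k\,c_{2n-2k+1}\qquad(n\ge0),$$ and with no other sequence of real coefficients; (d) with $C_n(0)$ given by the formula in (c), $C_n(0)=\lim_{\eta\to0}C_n(\eta)$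 for every $n\ge0$ (equivalently, the limit is taken as $\lambda\to1$, $\lambda\neq1$). -/

import Mathlib

open Filter Topology MeasureTheory Asymptotics

/-- Poincaré asymptotic expansion `F x ~ ∑ₙ c n * φ n x` as `x → +∞`, with respect to the
scale `φ 0, φ 1, …`: for every `N`, the remainder after the first `N` terms is `O(φ N)`. -/
def HasAsymptoticExpansion (F : ℝ → ℝ) (φ : ℕ → ℝ → ℝ) (c : ℕ → ℝ) : Prop :=
  ∀ N : ℕ, (fun x : ℝ => F x - ∑ n ∈ Finset.range N, c n * φ n x) =O[atTop] φ N

/-- The (upper) incomplete gamma function `Γ(a, x) = ∫_x^∞ e^{-t} t^{a-1} dt`. -/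
noncomputable def incompleteGamma (a x : ℝ) : ℝ :=
  ∫ t in Set.Ioi x, Real.exp (-t) * t ^ (a - 1)

/-- The phase function `f(x) = x - log (1 + x)`. -/
noncomputable def phase (x : ℝ) : ℝ := x - Real.log (1 + x)

/-- The function `x² / (x - log (1 + x))`, with its removable singularity at `x = 0` filled in
by the limit value `2`. -/
noncomputable def phaseQuotient (x : ℝ) : ℝ := if x = 0 then 2 else x ^ 2 / phase x

/-- The Laplace coefficients `c_n` of `f(x) = x - log (1 + x)`, `g ≡ 1`, at the endpoint `0`:
`c_n = 1/(2 n!) [d^n/dx^n (x² / (x - log (1 + x)))^{(n+1)/2}]_{x=0}`. -/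
noncomputable def laplaceCoeff (n : ℕ) : ℝ :=
  1 / (2 * (n.factorial : ℝ)) *
    iteratedDeriv n (fun x : ℝ => phaseQuotient x ^ (((n : ℝ) + 1) / 2)) 0

/-- The Stirling coefficients `γ_n = (-1)^n √(2/π) Γ(n + 1/2) c_{2n}`. -/
noncomputable def stirlingCoeff (n : ℕ) : ℝ :=
  (-1) ^ n * Real.sqrt (2 / Real.pi) * Real.Gamma ((n : ℝ) + 1 / 2) * laplaceCoeff (2 * n)

/-- The variable `η` of the uniform expansion of the incomplete gamma function:
`η² / 2 = l - log l - 1`, where `η` has the sign of `l - 1`. -/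
noncomputable def temmeEta (l : ℝ) : ℝ :=
  Real.sign (l - 1) * Real.sqrt (2 * (l - Real.log l - 1))

/-- The coefficients `C_n(η)`, `η = temmeEta l`, `l > 0`, `l ≠ 1`, of Temme's uniform expansion
of the normalized incomplete gamma function `Γ(a, l a) / Γ(a)`. With `μ = l - 1`,
`C_n(η) = (-1)^n ( 1/(2^{2n+1/2} n!) [d^{2n}/dx^{2n} {(μ - x)⁻¹ (x²/(x - log(1+x)))^{n+1/2}}]_{x=0}
  - 2^n Γ(n+1/2) / (√π η^{2n+1}) )`. -/
noncomputable def temmeCoeff (n : ℕ) (l : ℝ) : ℝ :=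
  (-1) ^ n *
    (1 / ((2 : ℝ) ^ (2 * (n : ℝ) + 1 / 2) * (n.factorial : ℝ)) *
        iteratedDeriv (2 * n)
          (fun x : ℝ => (l - 1 - x)⁻¹ * phaseQuotient x ^ ((n : ℝ) + 1 / 2)) 0
      - 2 ^ n * Real.Gamma ((n : ℝ) + 1 / 2) /
          (Real.sqrt Real.pi * temmeEta l ^ (2 * n + 1)))

/-! Everything reduces to one change of variable. Put `P = √(x²/f)` and `S = x/P`, so `S² = f`.
Since `f' = x/(1+x)`, `S S' = x/(2(1+x))`, that is `S' = P/(2(1+x))`; this is the equation in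
`IsPhaseSeries`. By Lagrange inversion `2c_n` is the coefficient of `S^n` in `dx/dS`. Expanding `1 =
∑ 2c_n S^n S'` with a remainder (`exists_bound`) and integrating against `exp(-l S²)` over `(0, ∞)`
and over `(-1, 0)` gives Laplace expansions `R` and `L` that differ only in the signs of the odd
terms (`IsLaplaceSide.isBigO`). Then `Γ(a) = a^a e^{-a} (R + L)`, which yields Stirling's series
from the even `c_n`, and `Γ(a,a) = a^a e^{-a} (R - 1/a)`. Hence `Γ(a,a)/Γ(a) - 1/2 = ((R - L)/2 -
1/a) / (R + L)`, whose numerator involves only the odd `c_n`. Expanding the quotient needs the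
reciprocal of Stirling's series, which is the same series with alternating signs removed: `(∑ γ_n
z^n)(∑ (-1)^n γ_n z^n) = 1`. The Cauchy product is then the formula in (c), where `-1/3` is `c_1 -
1`. For Temme's coefficients, `C_n(η)` is a constant times the negated regular part `R_n` of
`S^{-(2n+1)}`, evaluated at `μ` (`temmeCoeff_eq`), so its limit is the constant term of `R_n`.
Differentiating powers of `S` gives `S R_{n+1} = k_n/P - (2n+1)⁻¹ dR_n/dS`, with `k_n` the
coefficient of `x^{2n+2}` in `P^{2n+3}`. Iterating it down to `n = 0` (`Gamma_mul_regCoeff`) gives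
both remaining facts: the coefficient of `S^0` in `R_n` is the sum in (c), and that of `S^1`,
together with the vanishing constant term of `S R_{n+1}`, is the reciprocal identity. -/

open PowerSeries in
/-- The differential equation satisfied by the Taylor series `P` at `0` of
`√(x² / (x - log (1 + x)))`. -/
structure IsPhaseSeries (P : PowerSeries ℝ) : Prop where
  ode : P ^ 3 = 2 * ((1 + X) * (P - X * d⁄dX ℝ P))
  pos : 0 < constantCoeff P

/-! ### Formal power series: Lagrange inversion in `S = X / P` and the recurrence for the regular
parts. -/

namespace IsPhaseSeries

open PowerSeries

variable {P : PowerSeries ℝ}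

/-- The coefficient of `S ^ m` in the expansion of `g` in powers of `S = X / P`
(Lagrange's inversion formula). -/
noncomputable def sCoeff (P : PowerSeries ℝ) (m : ℕ) (g : PowerSeries ℝ) : ℝ :=
  coeff m (g * (1 + X)⁻¹ * P ^ (m + 2)) / 2

/-- The coefficient of `S ^ m` in the expansion of `1 / P` in powers of `S = X / P`. -/
noncomputable def invCoeff (P : PowerSeries ℝ) (m : ℕ) : ℝ :=
  coeff m ((1 + X)⁻¹ * P ^ (m + 1)) / 2

/-- The negative of the regular part of the Laurent series `(P / X) ^ (2 n + 1)`. -/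
noncomputable def regPart (P : PowerSeries ℝ) (n : ℕ) : PowerSeries ℝ :=
  PowerSeries.mk fun j => -coeff (2 * n + 1 + j) (P ^ (2 * n + 1))

theorem inv_mul_one_add : (1 + X : PowerSeries ℝ)⁻¹ * (1 + X) = 1 :=
  PowerSeries.inv_mul_cancel _ (by simp)

theorem inv_mul_cube (h : IsPhaseSeries P) :
    (1 + X)⁻¹ * P ^ 3 = 2 * (P - X * d⁄dX ℝ P) := by
  rw [h.ode]
  linear_combination (2 * (P - X * d⁄dX ℝ P)) * inv_mul_one_add

theorem constantCoeff_sq (h : IsPhaseSeries P) : constantCoeff P ^ 2 = 2 := by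
  have h1 := congrArg constantCoeff h.ode
  simp only [map_pow, map_mul, map_add, map_sub, map_one, constantCoeff_X, zero_mul, sub_zero,
    add_zero, one_mul, map_ofNat] at h1
  have := h.pos
  have h2 : constantCoeff P * (constantCoeff P ^ 2 - 2) = 0 := by linear_combination h1
  rcases mul_eq_zero.1 h2 with h3 | h3
  · linarith
  · linarith

/-- The two sides are the coefficient of `S^m` in `dg/dS`, read as residues of `g S'/S^{m+2}` (times
`m + 1`) and of `g'/S^{m+1}`. They agree because the derivative of `g/S^{m+1}` has no residue. -/
theorem sCoeff_succ (h : IsPhaseSeries P) (m : ℕ) (g : PowerSeries ℝ) :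
    ((m : ℝ) + 1) * sCoeff P (m + 1) g = coeff m (d⁄dX ℝ g * P ^ (m + 1)) := by
  set A := g * P ^ (m + 1) - X * (g * P ^ m * d⁄dX ℝ P) with hA
  have h1 : g * (1 + X)⁻¹ * P ^ (m + 1 + 2) = A + A := by
    rw [hA]
    linear_combination (g * P ^ m) * h.inv_mul_cube
  have h2 : coeff (m + 1) A = coeff (m + 1) (g * P ^ (m + 1)) - coeff m (g * P ^ m * d⁄dX ℝ P) := by
    rw [hA, map_sub, coeff_succ_X_mul]
  have h3 : coeff (m + 1) (g * P ^ (m + 1)) * ((m : ℝ) + 1) =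
      coeff m (d⁄dX ℝ g * P ^ (m + 1)) + ((m : ℝ) + 1) * coeff m (g * P ^ m * d⁄dX ℝ P) := by
    rw [← coeff_derivative]
    have : d⁄dX ℝ (g * P ^ (m + 1)) =
        d⁄dX ℝ g * P ^ (m + 1) + C ((m : ℝ) + 1) * (g * P ^ m * d⁄dX ℝ P) := by
      rw [Derivation.leibniz, Derivation.leibniz_pow]
      simp only [smul_eq_mul, nsmul_eq_mul, Nat.add_sub_cancel]
      push_cast
      simp only [map_add, map_natCast, map_one]
      ring
    rw [this, map_add, coeff_C_mul]
  rw [sCoeff, h1, map_add, h2]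
  linear_combination h3

theorem sCoeff_zero (h : IsPhaseSeries P) (g : PowerSeries ℝ) :
    sCoeff P 0 g = constantCoeff g := by
  have h2 := h.constantCoeff_sq
  simp only [sCoeff, coeff_zero_eq_constantCoeff, map_mul, map_pow, zero_add,
    PowerSeries.constantCoeff_inv, map_add, map_one, constantCoeff_X, add_zero, inv_one, mul_one]
  rw [h2]; ring

theorem sCoeff_one (h : IsPhaseSeries P) (m : ℕ) : sCoeff P m 1 = if m = 0 then 1 else 0 := by
  cases m with
  | zero => simp [h.sCoeff_zero]
  | succ m =>
    have := h.sCoeff_succ m 1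
    rw [Derivation.map_one_eq_zero, zero_mul, map_zero] at this
    have h3 : (m : ℝ) + 1 ≠ 0 := by positivity
    simpa [h3] using this

/-- From `S' = P/(2(1+X))`, half of `dX/dS` is `(1+X)/P = 1/P + S`. So the two expansions differ
only at `m = 1`. -/
theorem coeff_pow_succ (h : IsPhaseSeries P) (m : ℕ) :
    coeff m (P ^ (m + 1)) / 2 = invCoeff P m + if m = 1 then 1 else 0 := by
  have h1 : P ^ (m + 1) = (1 + X)⁻¹ * P ^ (m + 1) + X * ((1 + X)⁻¹ * P ^ (m + 1)) := by
    linear_combination - P ^ (m + 1) * inv_mul_one_add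
  rw [h1, map_add, add_div, ← invCoeff]
  congr 1
  cases m with
  | zero => simp
  | succ m =>
    rw [coeff_succ_X_mul]
    have := h.sCoeff_one m
    rw [sCoeff, one_mul] at this
    rw [this]; simp

/-- With `k = 2n+1`, `d/dX S^{-k} = -k S^{-k-2} S S'` gives `X S^{-(k+2)} = -(2/k)(1+X) d/dX
S^{-k}`. Taking regular parts, the only contribution from a principal part is the residue of
`S^{-(k+2)}`, which multiplication by `X` turns into the constant term. -/
theorem X_mul_regPart_succ (h : IsPhaseSeries P) (n : ℕ) :
    X * regPart P (n + 1) = C (coeff (2 * (n + 1)) (P ^ (2 * (n + 1) + 1)))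
      - C (2 / (2 * (n : ℝ) + 1)) * ((1 + X) * d⁄dX ℝ (regPart P n)) := by
  set k : ℕ := 2 * n + 1 with hk
  set t : ℕ → ℝ := fun i => coeff i (P ^ k) with ht
  have hkR : (2 * (n : ℝ) + 1) = (k : ℝ) := by rw [hk]; push_cast; ring
  have hk0 : (k : ℝ) ≠ 0 := by rw [← hkR]; positivity
  -- The differential equation multiplied by `k P^{k-1}`: the same identity cleared of negative
  -- powers of `X`.
  have hP : C (k : ℝ) * P ^ (k + 2) = C (2 : ℝ) * ((1 + X) * (C (k : ℝ) * P ^ k - X * d⁄dX ℝ (P ^ k))) := by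
    rw [Derivation.leibniz_pow]
    simp only [smul_eq_mul, nsmul_eq_mul, map_natCast, map_ofNat]
    have : P ^ k = P ^ (k - 1) * P := by rw [← pow_succ, show k - 1 + 1 = k by omega]
    rw [show P ^ (k + 2) = P ^ (k - 1) * P ^ 3 by rw [← pow_add]; congr 1, this, h.ode]
    ring
  have hcoef : ∀ j, (k : ℝ) * coeff (k + 1 + j) (P ^ (k + 2)) =
      -2 * (((j : ℝ) + 1) * t (k + 1 + j) + (j : ℝ) * t (k + j)) := by
    intro j
    have h1 := congrArg (coeff (k + 1 + j)) hP
    rw [coeff_C_mul, coeff_C_mul, add_mul, one_mul, map_add,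
      show k + 1 + j = (k + j) + 1 by ring, coeff_succ_X_mul, map_sub, map_sub, coeff_C_mul,
      coeff_C_mul, coeff_succ_X_mul, coeff_derivative,
      show k + j = (k + j - 1) + 1 by omega, coeff_succ_X_mul, coeff_derivative,
      show (k + j - 1) + 1 = k + j by omega] at h1
    have hc : (((k + j - 1 : ℕ) : ℝ)) = (k : ℝ) + j - 1 := by
      rw [Nat.cast_sub (by omega)]; push_cast; ring
    rw [hc] at h1
    rw [show k + 1 + j = k + j + 1 by ring, h1, ht]
    push_cast
    ring
  have hL : X * regPart P (n + 1) = C (coeff (2 * (n + 1)) (P ^ (2 * (n + 1) + 1)))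
      - PowerSeries.mk (fun j => coeff (k + 1 + j) (P ^ (k + 2))) := by
    ext j
    have hk2 : 2 * (n + 1) + 1 = k + 2 := by omega
    have hk3 : 2 * (n + 1) = k + 1 := by omega
    cases j with
    | zero =>
      simp [hk3]
    | succ j =>
      rw [coeff_succ_X_mul, map_sub, coeff_mk, regPart, coeff_mk, coeff_C, if_neg (by omega), hk2,
        zero_sub, show k + 1 + (j + 1) = k + 2 + j by ring]
  rw [hL]
  congr 1
  ext j
  rw [coeff_mk, coeff_C_mul, add_mul, one_mul, map_add, coeff_derivative, hkR]
  have e1 : coeff (j + 1) (regPart P n) = - t (k + 1 + j) := by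
    rw [regPart, coeff_mk, ← hk, show k + (j + 1) = k + 1 + j by ring]
  have e2 : coeff j (X * d⁄dX ℝ (regPart P n)) = -((j : ℝ) * t (k + j)) := by
    cases j with
    | zero => simp
    | succ j =>
      rw [coeff_succ_X_mul, coeff_derivative, regPart, coeff_mk, ← hk]
      push_cast
      ring
  rw [e1, e2]
  have := hcoef j
  field_simp
  linear_combination this

theorem X_mul_regPart_zero :
    (X : PowerSeries ℝ) * regPart P 0 = C (constantCoeff P) - P := by
  ext j
  cases j with
  | zero => simp
  | succ j =>
    rw [coeff_succ_X_mul, map_sub, coeff_C, if_neg (by omega), regPart, coeff_mk]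
    simp [add_comm]

theorem sCoeff_regPart_zero (h : IsPhaseSeries P) (m : ℕ) :
    sCoeff P m (regPart P 0) = constantCoeff P * invCoeff P (m + 1) := by
  have h1 : X * (regPart P 0 * (1 + X)⁻¹ * P ^ (m + 2)) =
      C (constantCoeff P) * ((1 + X)⁻¹ * P ^ (m + 1 + 1)) - 1 * (1 + X)⁻¹ * P ^ (m + 1 + 2) := by
    linear_combination ((1 + X)⁻¹ * P ^ (m + 2)) * X_mul_regPart_zero (P := P)
  have h2 := congrArg (coeff (m + 1)) h1
  rw [coeff_succ_X_mul, map_sub, coeff_C_mul] at h2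
  have h3 := h.sCoeff_one (m + 1)
  rw [sCoeff] at h3 ⊢
  rw [invCoeff, h2]
  simp only [Nat.add_eq_zero_iff, one_ne_zero, and_false, if_false] at h3
  linear_combination -h3

/-- Since `(1+X) d/dX = (P/2) d/dS`, dividing the recurrence by `P` gives an identity for `S
R_{n+1}` in terms of `1/P` and `dR_n/dS`. This is its coefficient of `S^m`; positive `m` gives a
recurrence, `m = 0` a constraint, as `S R_{n+1}` has no constant term. -/
theorem X_mul_regPart_succ_mul (h : IsPhaseSeries P) (n m : ℕ) :
    coeff m (X * (regPart P (n + 1) * (1 + X)⁻¹ * P ^ (m + 1))) / 2 =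
      coeff (2 * (n + 1)) (P ^ (2 * (n + 1) + 1)) * invCoeff P m
        - ((m : ℝ) + 1) / (2 * n + 1) * sCoeff P (m + 1) (regPart P n) := by
  have h1 : X * (regPart P (n + 1) * (1 + X)⁻¹ * P ^ (m + 1)) =
      C (coeff (2 * (n + 1)) (P ^ (2 * (n + 1) + 1))) * ((1 + X)⁻¹ * P ^ (m + 1))
      - C (2 / (2 * (n : ℝ) + 1)) * (d⁄dX ℝ (regPart P n) * P ^ (m + 1)) := by
    linear_combination ((1 + X)⁻¹ * P ^ (m + 1)) * h.X_mul_regPart_succ n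
      - C (2 / (2 * (n : ℝ) + 1)) * (d⁄dX ℝ (regPart P n) * P ^ (m + 1)) * inv_mul_one_add
  rw [h1, map_sub, coeff_C_mul, coeff_C_mul, ← h.sCoeff_succ, invCoeff]
  ring

theorem sCoeff_regPart_succ (h : IsPhaseSeries P) (n m : ℕ) :
    sCoeff P m (regPart P (n + 1)) =
      coeff (2 * (n + 1)) (P ^ (2 * (n + 1) + 1)) * invCoeff P (m + 1)
        - ((m : ℝ) + 2) / (2 * n + 1) * sCoeff P (m + 2) (regPart P n) := by
  have h1 := h.X_mul_regPart_succ_mul n (m + 1)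
  rw [coeff_succ_X_mul] at h1
  rw [sCoeff, h1]
  push_cast
  ring

theorem sCoeff_one_regPart (h : IsPhaseSeries P) (n : ℕ) :
    coeff (2 * (n + 1)) (P ^ (2 * (n + 1) + 1)) * invCoeff P 0 =
      1 / (2 * n + 1) * sCoeff P 1 (regPart P n) := by
  have h1 := h.X_mul_regPart_succ_mul n 0
  rw [coeff_zero_X_mul, zero_div] at h1
  push_cast at h1
  rw [zero_add] at h1
  linear_combination -h1

/-- Lagrange's inversion formula for `S = X / P`, whose derivative is `P / (2 (1 + X))`. -/
theorem X_pow_dvd_one_sub (h : IsPhaseSeries P) (N : ℕ) :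
    (X : PowerSeries ℝ) ^ N ∣ 1 - ∑ n ∈ Finset.range N,
      C (coeff n (P ^ (n + 1)) / 2) * ((X * P⁻¹) ^ n * (P * (1 + X)⁻¹)) := by
  set D := 1 - ∑ n ∈ Finset.range N,
      C (coeff n (P ^ (n + 1)) / 2) * ((X * P⁻¹) ^ n * (P * (1 + X)⁻¹)) with hD
  have hinv : P⁻¹ * P = 1 := PowerSeries.inv_mul_cancel _ h.pos.ne'
  have hterm : ∀ k n : ℕ, coeff k ((X * P⁻¹) ^ n * (P * (1 + X)⁻¹) * P ^ (k + 1)) =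
      if n = k then 2 else 0 := by
    intro k n
    rw [mul_pow]
    rcases lt_or_ge k n with hkn | hkn
    · rw [if_neg (by omega), mul_assoc, mul_assoc, coeff_X_pow_mul', if_neg (by omega)]
    · obtain ⟨j, rfl⟩ := Nat.exists_eq_add_of_le hkn
      have : (X : PowerSeries ℝ) ^ n * P⁻¹ ^ n * (P * (1 + X)⁻¹) * P ^ (n + j + 1) =
          X ^ n * (1 * (1 + X)⁻¹ * P ^ (j + 2)) := by
        have h1 : P⁻¹ ^ n * P ^ n = 1 := by rw [← mul_pow, hinv, one_pow]
        linear_combination (X ^ n * (P * (1 + X)⁻¹) * P ^ (j + 1)) * h1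
      rw [this, add_comm n j, coeff_X_pow_mul]
      have h2 := h.sCoeff_one j
      rw [sCoeff] at h2
      by_cases hj : j = 0
      · subst hj
        simp only [if_true] at h2
        rw [if_pos (by omega)]; linarith
      · rw [if_neg hj] at h2
        rw [if_neg (by omega)]; linarith
  have hcoef : ∀ k < N, coeff k (D * P ^ (k + 1)) = 0 := by
    intro k hk
    rw [hD, sub_mul, one_mul, Finset.sum_mul, map_sub, map_sum]
    have : ∀ n ∈ Finset.range N, coeff k (C (coeff n (P ^ (n + 1)) / 2) *
        ((X * P⁻¹) ^ n * (P * (1 + X)⁻¹)) * P ^ (k + 1)) =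
        if n = k then coeff k (P ^ (k + 1)) else 0 := by
      intro n _
      rw [mul_assoc, coeff_C_mul, hterm]
      split_ifs with hnk
      · subst hnk; ring
      · ring
    rw [Finset.sum_congr rfl this, Finset.sum_ite_eq', if_pos (Finset.mem_range.2 hk), sub_self]
  have key : ∀ k ≤ N, (X : PowerSeries ℝ) ^ k ∣ D := by
    intro k
    induction k with
    | zero => intro _; simp
    | succ k ih =>
      intro hk
      obtain ⟨U, hU⟩ := ih (by omega)
      have h1 := hcoef k (by omega)
      rw [hU, mul_assoc] at h1
      have h2 : coeff (0 + k) ((X : PowerSeries ℝ) ^ k * (U * P ^ (k + 1))) = 0 := by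
        rw [zero_add]; exact h1
      rw [coeff_X_pow_mul, coeff_zero_eq_constantCoeff, map_mul, map_pow] at h2
      have h3 : constantCoeff U = 0 := by
        rcases mul_eq_zero.1 h2 with h4 | h4
        · exact h4
        · exact absurd h4 (pow_ne_zero _ h.pos.ne')
      rw [hU, pow_succ]
      exact mul_dvd_mul_left _ (X_dvd_iff.2 h3)
  exact key N le_rfl

/-- Half the coefficient of `S ^ n` in the derivative of `X` with respect to `S = X / P`. -/
noncomputable def lagCoeff (P : PowerSeries ℝ) (n : ℕ) : ℝ := coeff n (P ^ (n + 1)) / 2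

/-- The Stirling coefficients in terms of the power series `P`. -/
noncomputable def stirCoeff (P : PowerSeries ℝ) (n : ℕ) : ℝ :=
  (-1) ^ n * Real.sqrt (2 / Real.pi) * Real.Gamma ((n : ℝ) + 1 / 2) * lagCoeff P (2 * n)

/-- The normalized coefficient of `S ^ m` in `regPart P n`. -/
noncomputable def regCoeff (P : PowerSeries ℝ) (n m : ℕ) : ℝ :=
  (-1) ^ n * (Real.sqrt (2 / Real.pi) / 2) * Real.Gamma ((n : ℝ) + 1 / 2) *
    sCoeff P m (regPart P n)

theorem Gamma_succ_half (n : ℕ) : Real.Gamma (((n + 1 : ℕ) : ℝ) + 1 / 2) =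
    ((n : ℝ) + 1 / 2) * Real.Gamma ((n : ℝ) + 1 / 2) := by
  rw [← Real.Gamma_add_one (by positivity)]
  congr 1; push_cast; ring

theorem regCoeff_zero (h : IsPhaseSeries P) (m : ℕ) :
    regCoeff P 0 m = stirCoeff P 0 * invCoeff P (m + 1) := by
  rw [regCoeff, h.sCoeff_regPart_zero, stirCoeff, lagCoeff]
  simp
  ring

theorem regCoeff_succ (h : IsPhaseSeries P) (n m : ℕ) :
    regCoeff P (n + 1) m = stirCoeff P (n + 1) * invCoeff P (m + 1)
      + ((m : ℝ) + 2) / 2 * regCoeff P n (m + 2) := by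
  rw [regCoeff, h.sCoeff_regPart_succ, stirCoeff, regCoeff, lagCoeff, Gamma_succ_half]
  have : 2 * (n : ℝ) + 1 ≠ 0 := by positivity
  field_simp
  ring

theorem stirCoeff_succ_mul (h : IsPhaseSeries P) (n : ℕ) :
    stirCoeff P (n + 1) * invCoeff P 0 = - (regCoeff P n 1 / 2) := by
  have h1 := h.sCoeff_one_regPart n
  rw [stirCoeff, regCoeff, Gamma_succ_half, lagCoeff]
  have : 2 * (n : ℝ) + 1 ≠ 0 := by positivity
  field_simp at h1
  rw [pow_succ]
  linear_combination (-(-1 : ℝ) ^ n * Real.sqrt (2 / Real.pi) * Real.Gamma ((n : ℝ) + 1 / 2) / 4)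
    * h1

/-- Each use of the recurrence lowers `n` by one and raises `m` by two, at the cost of a factor
`(m+2)/2`, which `Γ(z+1) = z Γ(z)` absorbs. -/
theorem Gamma_mul_regCoeff (h : IsPhaseSeries P) (n m : ℕ) :
    Real.Gamma ((m : ℝ) / 2 + 1) * regCoeff P n m = ∑ k ∈ Finset.range (n + 1),
      stirCoeff P k * invCoeff P (m + 1 + 2 * (n - k)) *
        Real.Gamma ((m : ℝ) / 2 + 1 + ((n - k : ℕ) : ℝ)) := by
  induction n generalizing m with
  | zero =>
    rw [h.regCoeff_zero]
    simp
    ring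
  | succ n ih =>
    rw [h.regCoeff_succ, Finset.sum_range_succ]
    have h1 := ih (m + 2)
    have e1 : (((m + 2 : ℕ) : ℝ)) / 2 + 1 = ((m : ℝ) / 2 + 1) + 1 := by push_cast; ring
    rw [e1, Real.Gamma_add_one (by positivity)] at h1
    have h2 : ∑ k ∈ Finset.range (n + 1), stirCoeff P k * invCoeff P (m + 1 + 2 * (n + 1 - k)) *
        Real.Gamma ((m : ℝ) / 2 + 1 + ((n + 1 - k : ℕ) : ℝ)) =
        ∑ k ∈ Finset.range (n + 1), stirCoeff P k * invCoeff P (m + 2 + 1 + 2 * (n - k)) *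
        Real.Gamma ((m : ℝ) / 2 + 1 + 1 + ((n - k : ℕ) : ℝ)) := by
      refine Finset.sum_congr rfl fun k hk => ?_
      have hk' : k ≤ n := by simpa [Nat.lt_succ_iff] using hk
      have e2 : n + 1 - k = n - k + 1 := by omega
      rw [e2]
      congr 2
      · congr 1; ring
      · push_cast; ring
    rw [h2, ← h1]
    simp
    ring

theorem invCoeff_of_ne (h : IsPhaseSeries P) {m : ℕ} (hm : m ≠ 1) :
    invCoeff P m = lagCoeff P m := by
  have := h.coeff_pow_succ m
  rw [if_neg hm, add_zero] at this
  rw [← this, lagCoeff]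

theorem lagCoeff_one (h : IsPhaseSeries P) : lagCoeff P 1 = 2 / 3 := by
  have h2 := h.constantCoeff_sq
  have hp := h.pos
  have h1 : P ^ 3 = (P - X * d⁄dX ℝ P + X * (P - X * d⁄dX ℝ P)) +
      (P - X * d⁄dX ℝ P + X * (P - X * d⁄dX ℝ P)) := by rw [h.ode]; ring
  have h3 := congrArg (coeff 1) h1
  have e : ∀ g : PowerSeries ℝ, coeff 1 (X * g) = constantCoeff g := fun g => by
    rw [show (1 : ℕ) = 0 + 1 by rfl, coeff_succ_X_mul, coeff_zero_eq_constantCoeff]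
  have m2 : ∀ f g : PowerSeries ℝ, coeff 1 (f * g) =
      coeff 1 f * constantCoeff g + constantCoeff f * coeff 1 g := fun f g => by
    rw [coeff_mul, Finset.Nat.sum_antidiagonal_eq_sum_range_succ_mk, Finset.sum_range_succ,
      Finset.sum_range_one]
    simp
    ring
  have hd : constantCoeff (d⁄dX ℝ P) = coeff 1 P := by
    rw [← coeff_zero_eq_constantCoeff_apply, coeff_derivative]; simp
  rw [map_add, map_add, map_sub, e, e, map_sub, hd, map_mul, constantCoeff_X, zero_mul, sub_zero,
    pow_succ, pow_two, m2, m2, map_mul] at h3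
  have h4 : constantCoeff P * (3 * constantCoeff P * coeff 1 P - 2) = 0 := by
    linear_combination h3
  have h5 : 3 * constantCoeff P * coeff 1 P = 2 := by
    rcases mul_eq_zero.1 h4 with h6 | h6
    · exact absurd h6 hp.ne'
    · linarith
  rw [lagCoeff, show 1 + 1 = 2 by rfl, pow_two, m2]
  linear_combination h5 / 3

theorem stirCoeff_zero (h : IsPhaseSeries P) : stirCoeff P 0 = 1 := by
  have h2 := h.constantCoeff_sq
  have hp : constantCoeff P = Real.sqrt 2 := by
    rw [← h2, Real.sqrt_sq h.pos.le]
  rw [stirCoeff, lagCoeff]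
  simp only [pow_zero, one_mul, Nat.cast_zero, zero_add, mul_zero, pow_one,
    coeff_zero_eq_constantCoeff, hp, Real.Gamma_one_half_eq]
  rw [Real.sqrt_div (by norm_num)]
  have : Real.sqrt Real.pi ≠ 0 := by positivity
  field_simp
  exact Real.sq_sqrt (by norm_num)

/-- Reciprocal of the Stirling series: `(∑ γ_n z ^ n) (∑ (-1) ^ n γ_n z ^ n) = 1`. -/
theorem sum_stirCoeff_mul (h : IsPhaseSeries P) (n : ℕ) :
    ∑ k ∈ Finset.range (n + 2), stirCoeff P k * ((-1) ^ (n + 1 - k) * stirCoeff P (n + 1 - k)) =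
      0 := by
  -- At `m = 1` the iterated recurrence supplies the terms `k ≤ n`; the constraint
  -- `stirCoeff_succ_mul` supplies the missing term `k = n + 1`, which cancels them. Only even
  -- indices of `invCoeff` occur, where it equals `lagCoeff`.
  have h1 := h.Gamma_mul_regCoeff n 1
  have h2 := h.stirCoeff_succ_mul n
  have hg : Real.Gamma (((1 : ℕ) : ℝ) / 2 + 1) = 1 / 2 * Real.Gamma (1 / 2) := by
    rw [Nat.cast_one, Real.Gamma_add_one (by norm_num)]
  have h3 : ∑ k ∈ Finset.range (n + 2), stirCoeff P k * invCoeff P (2 * (n + 1 - k)) *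
      Real.Gamma (((n + 1 - k : ℕ) : ℝ) + 1 / 2) = 0 := by
    rw [Finset.sum_range_succ]
    have h4 : ∑ k ∈ Finset.range (n + 1), stirCoeff P k * invCoeff P (2 * (n + 1 - k)) *
      Real.Gamma (((n + 1 - k : ℕ) : ℝ) + 1 / 2) =
      Real.Gamma (((1 : ℕ) : ℝ) / 2 + 1) * regCoeff P n 1 := by
      rw [h1]
      refine Finset.sum_congr rfl fun k hk => ?_
      have hk' : k ≤ n := by simpa [Nat.lt_succ_iff] using hk
      have e2 : n + 1 - k = n - k + 1 := by omega
      rw [e2]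
      congr 2
      · congr 1; ring
      · push_cast; ring
    rw [h4, hg]
    simp only [Nat.sub_self, mul_zero, Nat.cast_zero, zero_add]
    linear_combination Real.Gamma (1 / 2) * h2
  have h5 : ∑ k ∈ Finset.range (n + 2),
      stirCoeff P k * ((-1) ^ (n + 1 - k) * stirCoeff P (n + 1 - k)) =
      Real.sqrt (2 / Real.pi) * ∑ k ∈ Finset.range (n + 2),
        stirCoeff P k * invCoeff P (2 * (n + 1 - k)) *
          Real.Gamma (((n + 1 - k : ℕ) : ℝ) + 1 / 2) := by
    rw [Finset.mul_sum]
    refine Finset.sum_congr rfl fun k _ => ?_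
    rw [stirCoeff.eq_1 P (n + 1 - k), h.invCoeff_of_ne (by omega)]
    have : ((-1 : ℝ) ^ (n + 1 - k)) * (-1) ^ (n + 1 - k) = 1 := by
      rw [← mul_pow]; norm_num
    linear_combination (stirCoeff P k * Real.sqrt (2 / Real.pi) *
      Real.Gamma (((n + 1 - k : ℕ) : ℝ) + 1 / 2) * lagCoeff P (2 * (n + 1 - k))) * this
  rw [h5, h3, mul_zero]

/-- The odd coefficients of `1 / P`, in the form in which they enter the expansion of
`Γ(a, a) / Γ(a)`. -/
theorem invCoeff_odd (h : IsPhaseSeries P) (j : ℕ) :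
    invCoeff P (2 * j + 1) = lagCoeff P (2 * j + 1) - if j = 0 then 1 else 0 := by
  have := h.coeff_pow_succ (2 * j + 1)
  rw [lagCoeff, this]
  by_cases hj : j = 0 <;> simp [hj]

theorem regCoeff_eq_sum (h : IsPhaseSeries P) (n : ℕ) :
    regCoeff P n 0 = ∑ k ∈ Finset.range (n + 1),
      stirCoeff P k * (((n - k).factorial : ℝ) * invCoeff P (2 * (n - k) + 1)) := by
  have h1 := h.Gamma_mul_regCoeff n 0
  rw [Nat.cast_zero, zero_div, zero_add, Real.Gamma_one, one_mul] at h1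
  rw [h1]
  refine Finset.sum_congr rfl fun k _ => ?_
  rw [add_comm 1 (((n - k : ℕ)) : ℝ), Real.Gamma_nat_eq_factorial, zero_add, add_comm 1]
  ring

/-- The term `k = n` of the preceding sum is separated off: there `invCoeff P 1 = c_1 - 1 = -1/3`.
In all other terms `invCoeff` and `lagCoeff` agree. -/
theorem regCoeff_eq (h : IsPhaseSeries P) (n : ℕ) :
    regCoeff P n 0 = -stirCoeff P n / 3 + ∑ k ∈ Finset.range n,
      ((n - k).factorial : ℝ) * stirCoeff P k * lagCoeff P (2 * (n - k) + 1) := by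
  rw [h.regCoeff_eq_sum, Finset.sum_range_succ, Nat.sub_self, h.invCoeff_odd]
  have h1 := h.lagCoeff_one
  simp only [mul_zero, zero_add, h1, if_true, Nat.factorial_zero, Nat.cast_one]
  rw [add_comm]
  congr 1
  · ring
  refine Finset.sum_congr rfl fun k hk => ?_
  have hk' : n - k ≠ 0 := by have := Finset.mem_range.1 hk; omega
  rw [h.invCoeff_odd, if_neg hk']
  ring

theorem regCoeff_eq_coeff (h : IsPhaseSeries P) (n : ℕ) :
    regCoeff P n 0 = (-1) ^ n * (Real.sqrt (2 / Real.pi) / 2) * Real.Gamma ((n : ℝ) + 1 / 2) *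
      (-coeff (2 * n + 1) (P ^ (2 * n + 1))) := by
  rw [regCoeff, h.sCoeff_zero, ← coeff_zero_eq_constantCoeff_apply, regPart, coeff_mk, add_zero]

end IsPhaseSeries

/-! ### Taylor series at `0` as a homomorphism from analytic germs to power series. -/

section TaylorSeries

open PowerSeries

/-- The Taylor series at `0` of a real function. -/
noncomputable def taylorSeries (g : ℝ → ℝ) : PowerSeries ℝ :=
  PowerSeries.mk fun n => iteratedDeriv n g 0 / (n.factorial : ℝ)

theorem coeff_taylorSeries (g : ℝ → ℝ) (n : ℕ) :
    coeff n (taylorSeries g) = iteratedDeriv n g 0 / (n.factorial : ℝ) := coeff_mk _ _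

theorem iteratedDeriv_eq_coeff_taylorSeries (g : ℝ → ℝ) (n : ℕ) :
    iteratedDeriv n g 0 = (n.factorial : ℝ) * coeff n (taylorSeries g) := by
  rw [coeff_taylorSeries, mul_div_cancel₀]
  positivity

theorem constantCoeff_taylorSeries (g : ℝ → ℝ) : constantCoeff (taylorSeries g) = g 0 := by
  rw [← coeff_zero_eq_constantCoeff_apply, coeff_taylorSeries]; simp

theorem taylorSeries_congr {f g : ℝ → ℝ} (h : f =ᶠ[𝓝 0] g) : taylorSeries f = taylorSeries g := by
  ext n
  rw [coeff_taylorSeries, coeff_taylorSeries, h.iteratedDeriv_eq]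

theorem taylorSeries_add {f g : ℝ → ℝ} (hf : AnalyticAt ℝ f 0) (hg : AnalyticAt ℝ g 0) :
    taylorSeries (fun x => f x + g x) = taylorSeries f + taylorSeries g := by
  ext n
  have := iteratedDeriv_add (n := n) hf.contDiffAt hg.contDiffAt
  rw [map_add, coeff_taylorSeries, coeff_taylorSeries, coeff_taylorSeries, ← add_div, ← this]
  rfl

theorem taylorSeries_sub {f g : ℝ → ℝ} (hf : AnalyticAt ℝ f 0) (hg : AnalyticAt ℝ g 0) :
    taylorSeries (fun x => f x - g x) = taylorSeries f - taylorSeries g := by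
  ext n
  have := iteratedDeriv_sub (n := n) hf.contDiffAt hg.contDiffAt
  rw [map_sub, coeff_taylorSeries, coeff_taylorSeries, coeff_taylorSeries, ← sub_div, ← this]
  rfl

theorem taylorSeries_mul {f g : ℝ → ℝ} (hf : AnalyticAt ℝ f 0) (hg : AnalyticAt ℝ g 0) :
    taylorSeries (fun x => f x * g x) = taylorSeries f * taylorSeries g := by
  ext n
  rw [coeff_mul, Finset.Nat.sum_antidiagonal_eq_sum_range_succ_mk, coeff_taylorSeries,
    iteratedDeriv_fun_mul hf.contDiffAt hg.contDiffAt, Finset.sum_div]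
  refine Finset.sum_congr rfl fun k hk => ?_
  have hk' : k ≤ n := by simpa [Nat.lt_succ_iff] using hk
  rw [coeff_taylorSeries, coeff_taylorSeries, Nat.cast_choose ℝ hk']
  have h1 : (n.factorial : ℝ) ≠ 0 := by positivity
  have h2 : (k.factorial : ℝ) ≠ 0 := by positivity
  have h3 : ((n - k).factorial : ℝ) ≠ 0 := by positivity
  field_simp

theorem taylorSeries_const (c : ℝ) : taylorSeries (fun _ => c) = C c := by
  ext n
  rw [coeff_taylorSeries, iteratedDeriv_const, coeff_C]
  split_ifs with h
  · subst h; simp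
  · simp

theorem taylorSeries_id : taylorSeries (fun x => x) = X := by
  ext n
  rw [coeff_taylorSeries, iteratedDeriv_fun_id_zero, coeff_X]
  split_ifs with h
  · subst h; simp
  · simp

theorem taylorSeries_pow {f : ℝ → ℝ} (hf : AnalyticAt ℝ f 0) (n : ℕ) :
    taylorSeries (fun x => f x ^ n) = taylorSeries f ^ n := by
  induction n with
  | zero => simpa using taylorSeries_const 1
  | succ n ih =>
    simp only [pow_succ]
    rw [taylorSeries_mul (hf.fun_pow n) hf, ih]

theorem taylorSeries_id_pow (n : ℕ) : taylorSeries (fun x => x ^ n) = X ^ n := by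
  rw [taylorSeries_pow (f := fun x => x) (by fun_prop), taylorSeries_id]

theorem taylorSeries_const_add_id (c : ℝ) : taylorSeries (fun x => c + x) = C c + X := by
  rw [taylorSeries_add (f := fun _ => c) (g := fun x => x) analyticAt_const (by fun_prop),
    taylorSeries_const, taylorSeries_id]

theorem taylorSeries_const_sub_id (c : ℝ) : taylorSeries (fun x => c - x) = C c - X := by
  rw [taylorSeries_sub (f := fun _ => c) (g := fun x => x) analyticAt_const (by fun_prop),
    taylorSeries_const, taylorSeries_id]

theorem taylorSeries_sum {ι : Type*} (s : Finset ι) {f : ι → ℝ → ℝ}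
    (hf : ∀ i ∈ s, AnalyticAt ℝ (f i) 0) :
    taylorSeries (fun x => ∑ i ∈ s, f i x) = ∑ i ∈ s, taylorSeries (f i) := by
  classical
  induction s using Finset.induction_on with
  | empty => simpa using taylorSeries_const 0
  | insert a s ha ih =>
    simp only [Finset.sum_insert ha]
    rw [taylorSeries_add (hf a (Finset.mem_insert_self a s))
      (Finset.analyticAt_fun_sum s fun i hi => hf i (Finset.mem_insert_of_mem hi)),
      ih fun i hi => hf i (Finset.mem_insert_of_mem hi)]

theorem taylorSeries_deriv (f : ℝ → ℝ) : taylorSeries (deriv f) = d⁄dX ℝ (taylorSeries f) := by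
  ext n
  rw [coeff_derivative, coeff_taylorSeries, coeff_taylorSeries, iteratedDeriv_succ',
    Nat.factorial_succ]
  push_cast
  have h1 : (n.factorial : ℝ) ≠ 0 := by positivity
  have h2 : (n : ℝ) + 1 ≠ 0 := by positivity
  field_simp

/-- This carries formal divisibility back to functions; all local estimates at `0` rest on it. -/
theorem exists_eventually_eq_pow_mul {f : ℝ → ℝ} (hf : AnalyticAt ℝ f 0) {n : ℕ}
    (h : X ^ n ∣ taylorSeries f) :
    ∃ g : ℝ → ℝ, AnalyticAt ℝ g 0 ∧ ∀ᶠ x in 𝓝 (0 : ℝ), f x = x ^ n * g x := by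
  have h1 : (n : ℕ∞) ≤ analyticOrderAt f 0 := by
    rw [natCast_le_analyticOrderAt_iff_iteratedDeriv_eq_zero hf]
    intro i hi
    rw [iteratedDeriv_eq_coeff_taylorSeries, X_pow_dvd_iff.1 h i hi, mul_zero]
  simpa using (natCast_le_analyticOrderAt hf).1 h1

theorem tendsto_sub_sum_div_pow {f : ℝ → ℝ} (hf : AnalyticAt ℝ f 0) (n : ℕ) :
    Tendsto (fun x => (f x - ∑ j ∈ Finset.range n, coeff j (taylorSeries f) * x ^ j) / x ^ n)
      (𝓝[≠] 0) (𝓝 (coeff n (taylorSeries f))) := by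
  have hterm : ∀ j, AnalyticAt ℝ (fun x : ℝ => coeff j (taylorSeries f) * x ^ j) 0 :=
    fun j => by fun_prop
  have hs : AnalyticAt ℝ (fun x => ∑ j ∈ Finset.range n, coeff j (taylorSeries f) * x ^ j) 0 :=
    Finset.analyticAt_fun_sum _ fun j _ => hterm j
  have hT : taylorSeries (fun x => f x - ∑ j ∈ Finset.range n, coeff j (taylorSeries f) * x ^ j) =
      taylorSeries f - ∑ j ∈ Finset.range n, C (coeff j (taylorSeries f)) * X ^ j := by
    rw [taylorSeries_sub hf hs, taylorSeries_sum _ fun j _ => hterm j]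
    congr 1
    refine Finset.sum_congr rfl fun j _ => ?_
    rw [taylorSeries_mul analyticAt_const (by fun_prop), taylorSeries_const,
      taylorSeries_id_pow]
  have hcoef : ∀ k, coeff k (∑ j ∈ Finset.range n, C (coeff j (taylorSeries f)) * X ^ j) =
      if k < n then coeff k (taylorSeries f) else 0 := by
    intro k
    rw [map_sum]
    simp only [coeff_C_mul, coeff_X_pow, mul_ite, mul_one, mul_zero]
    rw [Finset.sum_ite_eq]
    simp
  have hd : X ^ n ∣
      taylorSeries (fun x => f x - ∑ j ∈ Finset.range n, coeff j (taylorSeries f) * x ^ j) := by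
    rw [X_pow_dvd_iff]
    intro m hm
    rw [hT, map_sub, hcoef, if_pos hm, sub_self]
  obtain ⟨g, hg, hfg⟩ := exists_eventually_eq_pow_mul (hf.fun_sub hs) hd
  have hg0 : g 0 = coeff n (taylorSeries f) := by
    have h1 := taylorSeries_congr hfg
    rw [hT, taylorSeries_mul (by fun_prop) hg, taylorSeries_id_pow] at h1
    have h2 := congrArg (coeff (0 + n)) h1
    rw [coeff_X_pow_mul, map_sub, zero_add, hcoef, if_neg (lt_irrefl n), sub_zero,
      coeff_zero_eq_constantCoeff, constantCoeff_taylorSeries] at h2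
    exact h2.symm
  rw [← hg0]
  refine (hg.continuousAt.tendsto.mono_left nhdsWithin_le_nhds).congr' ?_
  filter_upwards [nhdsWithin_le_nhds hfg, self_mem_nhdsWithin] with x hx hx0
  have : x ^ n ≠ 0 := pow_ne_zero _ hx0
  rw [hx]
  field_simp

end TaylorSeries

/-! ### The phase near `0`, and Temme's coefficients as Taylor remainders. -/

section Phase

open PowerSeries

theorem phase_zero : phase 0 = 0 := by simp [phase]

theorem phase_pos {x : ℝ} (hx : -1 < x) (h0 : x ≠ 0) : 0 < phase x := by
  have := Real.log_lt_sub_one_of_pos (x := 1 + x) (by linarith) (by simpa using h0)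
  rw [phase]; linarith

theorem hasDerivAt_phase {x : ℝ} (hx : -1 < x) : HasDerivAt phase (x / (1 + x)) x := by
  have h1 : HasDerivAt (fun y : ℝ => 1 + y) 1 x := by
    simpa using (hasDerivAt_id x).const_add 1
  have h2 := (hasDerivAt_id x).sub (h1.log (by linarith))
  have h3 : (1 : ℝ) + x ≠ 0 := by linarith
  convert! h2 using 1
  field_simp
  ring

theorem analyticAt_phase : AnalyticAt ℝ phase 0 := by
  have h1 : AnalyticAt ℝ (fun x : ℝ => 1 + x) 0 := by fun_prop
  exact analyticAt_id.sub (h1.log (by norm_num))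

theorem one_add_X_mul_taylorSeries_phase :
    (1 + X) * d⁄dX ℝ (taylorSeries phase) = X := by
  rw [← taylorSeries_deriv]
  have h1 : (fun x : ℝ => (1 + x) * deriv phase x) =ᶠ[𝓝 0] fun x => x := by
    filter_upwards [lt_mem_nhds (show (-1 : ℝ) < 0 by norm_num)] with x hx
    rw [(hasDerivAt_phase hx).deriv]
    have h3 : (1 : ℝ) + x ≠ 0 := by linarith
    field_simp
  have h2 := taylorSeries_congr h1
  rw [taylorSeries_mul (by fun_prop) analyticAt_phase.deriv, taylorSeries_id] at h2
  have h3 := taylorSeries_const_add_id 1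
  rw [map_one] at h3
  rw [← h3]
  exact h2

theorem exists_phase_eq_sq_mul : ∃ g : ℝ → ℝ, AnalyticAt ℝ g 0 ∧ g 0 = 1 / 2 ∧
    ∀ᶠ x in 𝓝 (0 : ℝ), phase x = x ^ 2 * g x := by
  have h := one_add_X_mul_taylorSeries_phase
  set F := taylorSeries phase with hF
  have hexp : d⁄dX ℝ F + X * d⁄dX ℝ F = X := by linear_combination h
  have e0 : coeff 0 F = 0 := by
    rw [coeff_zero_eq_constantCoeff_apply, constantCoeff_taylorSeries, phase_zero]
  have e1 : coeff 1 F = 0 := by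
    have := congrArg (coeff 0) hexp
    rw [map_add, coeff_zero_X_mul, coeff_derivative, coeff_zero_X] at this
    simpa using this
  have e2 : coeff 2 F = 1 / 2 := by
    have := congrArg (coeff (0 + 1)) hexp
    rw [map_add, coeff_succ_X_mul, coeff_derivative, coeff_derivative] at this
    simp only [zero_add, coeff_one_X, e1] at this
    norm_num at this
    linarith
  have hd : X ^ 2 ∣ F := by
    rw [X_pow_dvd_iff]
    intro m hm
    interval_cases m
    · exact e0
    · exact e1
  obtain ⟨g, hg, hfg⟩ := exists_eventually_eq_pow_mul analyticAt_phase hd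
  refine ⟨g, hg, ?_, hfg⟩
  have h1 := taylorSeries_congr hfg
  rw [taylorSeries_mul (by fun_prop) hg, taylorSeries_id_pow] at h1
  have h2 := congrArg (coeff (0 + 2)) h1
  rw [coeff_X_pow_mul, coeff_zero_eq_constantCoeff, constantCoeff_taylorSeries] at h2
  rw [← h2, zero_add]
  exact e2

/-- The square root of `x² / (x - log (1 + x))`. -/
noncomputable def phaseRoot (x : ℝ) : ℝ := Real.sqrt (phaseQuotient x)

theorem phaseQuotient_pos {x : ℝ} (hx : -1 < x) : 0 < phaseQuotient x := by
  rw [phaseQuotient]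
  split_ifs with h
  · norm_num
  · have := phase_pos hx h
    positivity

theorem phaseRoot_pos {x : ℝ} (hx : -1 < x) : 0 < phaseRoot x :=
  Real.sqrt_pos.2 (phaseQuotient_pos hx)

theorem phaseRoot_sq {x : ℝ} (hx : -1 < x) : phaseRoot x ^ 2 = phaseQuotient x :=
  Real.sq_sqrt (phaseQuotient_pos hx).le

theorem phaseRoot_sq_mul_phase {x : ℝ} (hx : -1 < x) : phaseRoot x ^ 2 * phase x = x ^ 2 := by
  rw [phaseRoot_sq hx, phaseQuotient]
  split_ifs with h
  · simp [h, phase_zero]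
  · have := (phase_pos hx h).ne'
    field_simp

theorem phaseQuotient_rpow {x : ℝ} (hx : -1 < x) (n : ℕ) :
    phaseQuotient x ^ ((n : ℝ) / 2) = phaseRoot x ^ n := by
  rw [phaseRoot, Real.sqrt_eq_rpow, ← Real.rpow_natCast, ← Real.rpow_mul (phaseQuotient_pos hx).le]
  congr 1
  ring

theorem analyticAt_phaseRoot : AnalyticAt ℝ phaseRoot 0 := by
  obtain ⟨g, hg, hg0, hfg⟩ := exists_phase_eq_sq_mul
  have hpos : ∀ᶠ x in 𝓝 (0 : ℝ), 0 < g x :=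
    hg.continuousAt.eventually_const_lt (by rw [hg0]; norm_num)
  have h1 : phaseRoot =ᶠ[𝓝 0] fun x => Real.exp (Real.log (g x)⁻¹ * (1 / 2)) := by
    filter_upwards [hfg, hpos] with x hx hgx
    have h2 : phaseQuotient x = (g x)⁻¹ := by
      rw [phaseQuotient]
      split_ifs with h0
      · rw [h0, hg0]; norm_num
      · rw [hx]; field_simp
    rw [phaseRoot, h2, Real.sqrt_eq_rpow, Real.rpow_def_of_pos (by positivity)]
  refine AnalyticAt.congr ?_ h1.symm
  have h3 : AnalyticAt ℝ (fun x => (g x)⁻¹) 0 := hg.fun_inv (by rw [hg0]; norm_num)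
  exact ((h3.log (by rw [hg0]; norm_num)).mul analyticAt_const).rexp'

theorem isPhaseSeries_taylorSeries : IsPhaseSeries (taylorSeries phaseRoot) := by
  have hpos : 0 < constantCoeff (taylorSeries phaseRoot) := by
    rw [constantCoeff_taylorSeries]
    exact phaseRoot_pos (by norm_num)
  refine ⟨?_, hpos⟩
  have hF := one_add_X_mul_taylorSeries_phase
  have hP : taylorSeries phaseRoot ^ 2 * taylorSeries phase = X ^ 2 := by
    rw [← taylorSeries_pow analyticAt_phaseRoot,
      ← taylorSeries_mul (analyticAt_phaseRoot.fun_pow 2) analyticAt_phase, ← taylorSeries_id_pow]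
    refine taylorSeries_congr ?_
    filter_upwards [lt_mem_nhds (show (-1 : ℝ) < 0 by norm_num)] with x hx
    exact phaseRoot_sq_mul_phase hx
  set P := taylorSeries phaseRoot
  set F := taylorSeries phase
  have hP0 : P ≠ 0 := by
    intro h
    rw [h] at hpos
    simp at hpos
  have hD := congrArg (d⁄dX ℝ) hP
  rw [Derivation.leibniz, Derivation.leibniz_pow, Derivation.leibniz_pow] at hD
  simp only [smul_eq_mul, nsmul_eq_mul, derivative_X] at hD
  have hX : (X : PowerSeries ℝ) ≠ 0 := X_ne_zero
  -- Times `X P`, the equation follows from `P² F = X²`, its derivative, and `(1+X) F' = X`.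
  refine mul_left_cancel₀ (mul_ne_zero hX hP0) ?_
  push_cast at hD
  linear_combination (1 + X) * P ^ 2 * hD - P ^ 4 * hF - 2 * (1 + X) * P * d⁄dX ℝ P * hP

theorem laplaceCoeff_eq (n : ℕ) :
    laplaceCoeff n = IsPhaseSeries.lagCoeff (taylorSeries phaseRoot) n := by
  have h1 : (fun x : ℝ => phaseQuotient x ^ (((n : ℝ) + 1) / 2)) =ᶠ[𝓝 0]
      fun x => phaseRoot x ^ (n + 1) := by
    filter_upwards [lt_mem_nhds (show (-1 : ℝ) < 0 by norm_num)] with x hx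
    rw [← phaseQuotient_rpow hx]
    push_cast
    rfl
  rw [laplaceCoeff, h1.iteratedDeriv_eq, iteratedDeriv_eq_coeff_taylorSeries,
    taylorSeries_pow analyticAt_phaseRoot, IsPhaseSeries.lagCoeff]
  have : (n.factorial : ℝ) ≠ 0 := by positivity
  field_simp

theorem stirlingCoeff_eq (n : ℕ) :
    stirlingCoeff n = IsPhaseSeries.stirCoeff (taylorSeries phaseRoot) n := by
  rw [stirlingCoeff, laplaceCoeff_eq, IsPhaseSeries.stirCoeff]

/-- Division by `m - X` is multiplication by a geometric series, so a single coefficient of the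
quotient sees a whole Taylor polynomial of `H` evaluated at `m`. -/
theorem pow_mul_coeff_of_mul_eq {m : ℝ} {K H : PowerSeries ℝ} (h : (C m - X) * K = H) (n : ℕ) :
    m ^ (n + 1) * coeff n K = ∑ j ∈ Finset.range (n + 1), coeff j H * m ^ j := by
  have h' : C m * K - X * K = H := by rw [← h]; ring
  induction n with
  | zero =>
    have := congrArg (coeff 0) h'
    rw [map_sub, coeff_C_mul, coeff_zero_X_mul] at this
    simp [← this]
  | succ n ih =>
    have := congrArg (coeff (n + 1)) h'
    rw [map_sub, coeff_C_mul, coeff_succ_X_mul] at this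
    rw [Finset.sum_range_succ, ← ih, ← this]
    ring

theorem Gamma_half_eq_factorial (n : ℕ) : (((2 * n).factorial : ℝ)) / (4 ^ n * n.factorial) =
    Real.Gamma ((n : ℝ) + 1 / 2) / Real.sqrt Real.pi := by
  induction n with
  | zero =>
    have : Real.sqrt Real.pi ≠ 0 := by positivity
    have h2 := Real.Gamma_one_half_eq
    rw [one_div] at h2
    simp [h2, this]
  | succ n ih =>
    rw [IsPhaseSeries.Gamma_succ_half, mul_div_assoc, ← ih,
      show 2 * (n + 1) = 2 * n + 1 + 1 by ring, Nat.factorial_succ, Nat.factorial_succ,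
      Nat.factorial_succ]
    push_cast
    have h1 : (n.factorial : ℝ) ≠ 0 := by positivity
    have h2 : (n : ℝ) + 1 ≠ 0 := by positivity
    field_simp
    ring

theorem temmeEta_eq {m : ℝ} (hm : -1 < m) (h0 : m ≠ 0) :
    temmeEta (m + 1) = Real.sqrt 2 * (m / phaseRoot m) := by
  have hp := phaseRoot_pos hm
  have h1 : Real.sqrt (phase m) = |m| / phaseRoot m := by
    rw [← Real.sqrt_sq (show 0 ≤ |m| / phaseRoot m by positivity), div_pow, sq_abs,
      ← phaseRoot_sq_mul_phase hm]
    congr 1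
    field_simp
  rw [temmeEta, show m + 1 - Real.log (m + 1) - 1 = phase m by rw [phase, add_comm 1 m]; ring,
    Real.sqrt_mul (by norm_num), h1, add_sub_cancel_right]
  rcases lt_or_gt_of_ne h0 with h | h
  · rw [Real.sign_of_neg h, abs_of_neg h]; ring
  · rw [Real.sign_of_pos h, abs_of_pos h]; ring

theorem iteratedDeriv_inv_sub_mul (n : ℕ) {m : ℝ} (h0 : m ≠ 0) :
    iteratedDeriv (2 * n) (fun x : ℝ => (m - x)⁻¹ * phaseQuotient x ^ ((n : ℝ) + 1 / 2)) 0 =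
      (2 * n).factorial * ((∑ j ∈ Finset.range (2 * n + 1),
        coeff j (taylorSeries fun x => phaseRoot x ^ (2 * n + 1)) * m ^ j) / m ^ (2 * n + 1)) := by
  have h1 : (fun x : ℝ => (m - x)⁻¹ * phaseQuotient x ^ ((n : ℝ) + 1 / 2)) =ᶠ[𝓝 0]
      fun x => (m - x)⁻¹ * phaseRoot x ^ (2 * n + 1) := by
    filter_upwards [lt_mem_nhds (show (-1 : ℝ) < 0 by norm_num)] with x hx
    rw [← phaseQuotient_rpow hx]
    push_cast
    congr 2
    ring
  have ha : AnalyticAt ℝ (fun x : ℝ => m - x) 0 := by fun_prop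
  have hi : AnalyticAt ℝ (fun x : ℝ => (m - x)⁻¹) 0 := ha.fun_inv (by simpa using h0)
  have hr := analyticAt_phaseRoot.fun_pow (2 * n + 1)
  have h2 : (fun x : ℝ => (m - x) * (m - x)⁻¹) =ᶠ[𝓝 0] fun _ => (1 : ℝ) := by
    filter_upwards [ha.continuousAt.eventually_ne (by simpa using h0)] with x hx
    exact mul_inv_cancel₀ hx
  have h3 := taylorSeries_congr h2
  rw [taylorSeries_mul ha hi, taylorSeries_const_sub_id, taylorSeries_const, map_one] at h3
  have h4 : (C m - X) * taylorSeries (fun x => (m - x)⁻¹ * phaseRoot x ^ (2 * n + 1)) =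
      taylorSeries fun x => phaseRoot x ^ (2 * n + 1) := by
    rw [taylorSeries_mul hi hr, ← mul_assoc, h3, one_mul]
  rw [h1.iteratedDeriv_eq, iteratedDeriv_eq_coeff_taylorSeries, ← pow_mul_coeff_of_mul_eq h4]
  have : m ^ (2 * n + 1) ≠ 0 := pow_ne_zero _ h0
  field_simp

/-- The derivative term is a Taylor polynomial of `phaseRoot^(2n+1)` over `m^(2n+1)`, and `η = √2 m
/ phaseRoot m` makes the other term the full function over the same power. `(2n)!/(4^n n!) =
Γ(n+1/2)/√π` equates the prefactors, leaving a Taylor remainder quotient. -/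
theorem temmeCoeff_eq (n : ℕ) {m : ℝ} (hm : -1 < m) (h0 : m ≠ 0) :
    temmeCoeff n (m + 1) = (-1) ^ n * (Real.sqrt (2 / Real.pi) / 2) *
      Real.Gamma ((n : ℝ) + 1 / 2) * -((phaseRoot m ^ (2 * n + 1) -
        ∑ j ∈ Finset.range (2 * n + 1),
          coeff j (taylorSeries fun x => phaseRoot x ^ (2 * n + 1)) * m ^ j) /
            m ^ (2 * n + 1)) := by
  have hp := phaseRoot_pos hm
  have hfac := Gamma_half_eq_factorial n
  have h2pow : (2 : ℝ) ^ (2 * (n : ℝ) + 1 / 2) = 4 ^ n * Real.sqrt 2 := by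
    rw [Real.rpow_add (by norm_num), Real.sqrt_eq_rpow, Real.rpow_mul (by norm_num)]
    norm_num
  have hs : Real.sqrt (2 / Real.pi) / 2 = 1 / (Real.sqrt 2 * Real.sqrt Real.pi) := by
    rw [Real.sqrt_div (by norm_num)]
    have : Real.sqrt Real.pi ≠ 0 := by positivity
    have h2 : Real.sqrt 2 ≠ 0 := by positivity
    field_simp
    exact Real.sq_sqrt (by norm_num)
  have h2n : (Real.sqrt 2) ^ (2 * n + 1) = 2 ^ n * Real.sqrt 2 := by
    rw [pow_succ, pow_mul, Real.sq_sqrt (by norm_num)]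
  rw [temmeCoeff, add_sub_cancel_right, iteratedDeriv_inv_sub_mul n h0, temmeEta_eq hm h0, h2pow,
    hs, mul_pow, h2n]
  set T := ∑ j ∈ Finset.range (2 * n + 1),
          coeff j (taylorSeries fun x => phaseRoot x ^ (2 * n + 1)) * m ^ j
  have hpi : Real.sqrt Real.pi ≠ 0 := by positivity
  have h2 : Real.sqrt 2 ≠ 0 := by positivity
  have hf : ((2 * n).factorial : ℝ) =
      Real.Gamma ((n : ℝ) + 1 / 2) / Real.sqrt Real.pi * (4 ^ n * n.factorial) := by
    rw [← hfac]
    have : (n.factorial : ℝ) ≠ 0 := by positivity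
    field_simp
  rw [hf, div_pow]
  have h3 : (n.factorial : ℝ) ≠ 0 := by positivity
  have h4 : m ^ (2 * n + 1) ≠ 0 := pow_ne_zero _ h0
  have h5 : phaseRoot m ^ (2 * n + 1) ≠ 0 := pow_ne_zero _ hp.ne'
  generalize m ^ (2 * n + 1) = M at *
  generalize phaseRoot m ^ (2 * n + 1) = Q at *
  field_simp
  ring

theorem tendsto_temmeCoeff (n : ℕ) : Tendsto (temmeCoeff n) (𝓝[≠] (1 : ℝ))
    (𝓝 (-stirlingCoeff n / 3 + ∑ k ∈ Finset.range n,
      ((n - k).factorial : ℝ) * stirlingCoeff k * laplaceCoeff (2 * (n - k) + 1))) := by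
  simp only [stirlingCoeff_eq, laplaceCoeff_eq]
  rw [← isPhaseSeries_taylorSeries.regCoeff_eq, isPhaseSeries_taylorSeries.regCoeff_eq_coeff,
    ← taylorSeries_pow analyticAt_phaseRoot]
  have h1 := ((tendsto_sub_sum_div_pow (analyticAt_phaseRoot.fun_pow (2 * n + 1))
    (2 * n + 1)).neg).const_mul
      ((-1) ^ n * (Real.sqrt (2 / Real.pi) / 2) * Real.Gamma ((n : ℝ) + 1 / 2))
  have h2 : Tendsto (fun l : ℝ => l - 1) (𝓝[≠] 1) (𝓝[≠] 0) := by
    refine tendsto_nhdsWithin_of_tendsto_nhds_of_eventually_within _ ?_ ?_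
    · have : Tendsto (fun l : ℝ => l - 1) (𝓝 1) (𝓝 (1 - 1)) :=
        (continuous_id.sub continuous_const).tendsto 1
      rw [sub_self] at this
      exact this.mono_left nhdsWithin_le_nhds
    · filter_upwards [self_mem_nhdsWithin] with l hl
      exact sub_ne_zero.2 hl
  refine (h1.comp h2).congr' ?_
  filter_upwards [self_mem_nhdsWithin,
    nhdsWithin_le_nhds (lt_mem_nhds (show (0 : ℝ) < 1 by norm_num))] with l hl hl0
  have := temmeCoeff_eq n (m := l - 1) (by linarith) (sub_ne_zero.2 hl)
  rw [sub_add_cancel] at this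
  rw [this]
  rfl

end Phase

/-! ### The coordinate `s = ±√f`, and the expansion of `1` in the functions `s^n s'` with a global
remainder bound. -/

section Coordinate

open PowerSeries

theorem taylorSeries_inv {f : ℝ → ℝ} (hf : AnalyticAt ℝ f 0) (h0 : f 0 ≠ 0) :
    taylorSeries (fun x => (f x)⁻¹) = (taylorSeries f)⁻¹ := by
  have h1 : (fun x => (f x)⁻¹ * f x) =ᶠ[𝓝 0] fun _ => (1 : ℝ) := by
    filter_upwards [hf.continuousAt.eventually_ne h0] with x hx
    exact inv_mul_cancel₀ hx
  have h2 := taylorSeries_congr h1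
  rw [taylorSeries_mul (hf.fun_inv h0) hf, taylorSeries_const, map_one] at h2
  rw [PowerSeries.eq_inv_iff_mul_eq_one]
  · exact h2
  · rwa [constantCoeff_taylorSeries]

/-- The coordinate `s` with `s² = x - log (1 + x)` and the sign of `x`. -/
noncomputable def phaseCoord (x : ℝ) : ℝ := x / phaseRoot x

/-- The derivative of `phaseCoord`. -/
noncomputable def phaseCoordDeriv (x : ℝ) : ℝ := phaseRoot x / (2 * (1 + x))

theorem phaseCoord_sq {x : ℝ} (hx : -1 < x) : phaseCoord x ^ 2 = phase x := by
  have := (phaseRoot_pos hx).ne'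
  rw [phaseCoord, div_pow, ← phaseRoot_sq_mul_phase hx]
  field_simp

theorem phaseCoordDeriv_pos {x : ℝ} (hx : -1 < x) : 0 < phaseCoordDeriv x := by
  have := phaseRoot_pos hx
  have : 0 < 1 + x := by linarith
  rw [phaseCoordDeriv]; positivity

theorem phaseCoord_pos {x : ℝ} (hx : 0 < x) : 0 < phaseCoord x :=
  div_pos hx (phaseRoot_pos (by linarith))

theorem phaseCoord_neg {x : ℝ} (hx : -1 < x) (h0 : x < 0) : phaseCoord x < 0 :=
  div_neg_of_neg_of_pos h0 (phaseRoot_pos hx)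

theorem phaseCoord_mul_deriv {x : ℝ} (hx : -1 < x) :
    phaseCoord x * phaseCoordDeriv x = x / (2 * (1 + x)) := by
  have := (phaseRoot_pos hx).ne'
  rw [phaseCoord, phaseCoordDeriv]
  field_simp

theorem phaseCoord_eq_sqrt {x : ℝ} (hx : 0 < x) : phaseCoord x = Real.sqrt (phase x) := by
  rw [← phaseCoord_sq (by linarith), Real.sqrt_sq (phaseCoord_pos hx).le]

theorem phaseCoord_eq_neg_sqrt {x : ℝ} (hx : -1 < x) (h0 : x < 0) :
    phaseCoord x = -Real.sqrt (phase x) := by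
  have := phaseCoord_neg hx h0
  rw [← phaseCoord_sq hx, ← neg_sq, Real.sqrt_sq (by linarith), neg_neg]

theorem hasDerivAt_phaseCoord {x : ℝ} (hx : -1 < x) (h0 : x ≠ 0) :
    HasDerivAt phaseCoord (phaseCoordDeriv x) x := by
  have hd := (hasDerivAt_phase hx).sqrt (phase_pos hx h0).ne'
  have h1 : (0 : ℝ) < 1 + x := by linarith
  have hsd := phaseCoord_mul_deriv hx
  rcases lt_or_gt_of_ne h0 with h | h
  · have hs := phaseCoord_neg hx h
    have he : phaseCoord =ᶠ[𝓝 x] fun y => -Real.sqrt (phase y) := by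
      filter_upwards [lt_mem_nhds hx, gt_mem_nhds h] with y hy1 hy2
      exact phaseCoord_eq_neg_sqrt hy1 hy2
    refine (hd.neg.congr_of_eventuallyEq he).congr_deriv ?_
    have : Real.sqrt (phase x) = - phaseCoord x := by rw [phaseCoord_eq_neg_sqrt hx h, neg_neg]
    rw [this, div_eq_iff (by linarith) |>.2 (by
      rw [div_eq_iff h1.ne'] at *
      rw [eq_div_iff (by positivity)] at hsd
      linear_combination -hsd : x / (1 + x) = -phaseCoordDeriv x * (2 * -phaseCoord x)), neg_neg]
  · have hs := phaseCoord_pos h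
    have he : phaseCoord =ᶠ[𝓝 x] fun y => Real.sqrt (phase y) := by
      filter_upwards [lt_mem_nhds h] with y hy1
      exact phaseCoord_eq_sqrt hy1
    refine (hd.congr_of_eventuallyEq he).congr_deriv ?_
    rw [← phaseCoord_eq_sqrt h, div_eq_iff (by linarith), div_eq_iff h1.ne']
    rw [eq_div_iff (by positivity)] at hsd
    linear_combination -hsd

theorem strictMonoOn_phaseCoord {A : Set ℝ} (hc : Convex ℝ A)
    (hA : ∀ x ∈ A, -1 < x ∧ x ≠ 0) : StrictMonoOn phaseCoord A := by
  refine strictMonoOn_of_deriv_pos hc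
    (fun x hx => (hasDerivAt_phaseCoord (hA x hx).1 (hA x hx).2).continuousAt.continuousWithinAt) ?_
  intro x hx
  have h := hA x (interior_subset hx)
  rw [(hasDerivAt_phaseCoord h.1 h.2).deriv]
  exact phaseCoordDeriv_pos h.1

theorem strictMonoOn_phaseCoord_Ioi : StrictMonoOn phaseCoord (Set.Ioi 0) :=
  strictMonoOn_phaseCoord (convex_Ioi 0) fun x (hx : 0 < x) => ⟨by linarith, hx.ne'⟩

theorem strictMonoOn_phaseCoord_Ioo : StrictMonoOn phaseCoord (Set.Ioo (-1) 0) :=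
  strictMonoOn_phaseCoord (convex_Ioo _ _) fun _ hx => ⟨hx.1, hx.2.ne⟩

theorem continuousOn_phase : ContinuousOn phase (Set.Ioi (-1)) :=
  fun _ hx => (hasDerivAt_phase hx).continuousAt.continuousWithinAt

theorem image_phaseCoord_Ioi : phaseCoord '' Set.Ioi 0 = Set.Ioi 0 := by
  refine Set.Subset.antisymm (Set.image_subset_iff.2 fun x hx => phaseCoord_pos hx) ?_
  intro y (hy : 0 < y)
  -- Here `log(2y²+2) = log(y²+1) + log 2 ≤ y² + 1`.
  have hM : y ^ 2 ≤ phase (2 * y ^ 2 + 1) := by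
    have h1 := Real.log_le_sub_one_of_pos (x := (1 + (2 * y ^ 2 + 1)) / 2) (by positivity)
    have h2 := Real.log_le_sub_one_of_pos (x := 2) (by positivity)
    rw [Real.log_div (by positivity) (by norm_num)] at h1
    rw [phase]
    linarith
  have hsub : Set.Icc (0 : ℝ) (2 * y ^ 2 + 1) ⊆ Set.Ioi (-1) := fun x hx => by
    have := hx.1
    simp only [Set.mem_Ioi]; linarith
  obtain ⟨x, hx, hxy⟩ := intermediate_value_Icc (by positivity) (continuousOn_phase.mono hsub)
    (show y ^ 2 ∈ Set.Icc (phase 0) (phase (2 * y ^ 2 + 1)) from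
      ⟨by rw [phase_zero]; positivity, hM⟩)
  have hx0 : 0 < x := by
    rcases hx.1.eq_or_lt with h | h
    · rw [← h, phase_zero] at hxy
      have : 0 < y ^ 2 := by positivity
      linarith
    · exact h
  exact ⟨x, hx0, by rw [phaseCoord_eq_sqrt hx0, hxy, Real.sqrt_sq hy.le]⟩

theorem image_phaseCoord_Ioo : phaseCoord '' Set.Ioo (-1) 0 = Set.Iio 0 := by
  refine Set.Subset.antisymm (Set.image_subset_iff.2 fun x hx => phaseCoord_neg hx.1 hx.2) ?_
  intro y (hy : y < 0)
  -- Chosen so that `phase a = y² + exp(-(y²+1))`.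
  set a : ℝ := -1 + Real.exp (-(y ^ 2 + 1)) with ha
  have hexp := Real.exp_pos (-(y ^ 2 + 1))
  have ha0 : a ≤ 0 := by
    have : Real.exp (-(y ^ 2 + 1)) ≤ 1 := Real.exp_le_one_iff.2 (by nlinarith [sq_nonneg y])
    linarith
  have hM : y ^ 2 ≤ phase a := by
    rw [phase, ha, add_neg_cancel_left, Real.log_exp]
    linarith
  have hsub : Set.Icc a 0 ⊆ Set.Ioi (-1) := fun x hx => by
    have := hx.1
    simp only [Set.mem_Ioi]; linarith
  obtain ⟨x, hx, hxy⟩ := intermediate_value_Icc' ha0 (continuousOn_phase.mono hsub)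
    (show y ^ 2 ∈ Set.Icc (phase 0) (phase a) from ⟨by rw [phase_zero]; positivity, hM⟩)
  have hx0 : x < 0 := by
    rcases hx.2.eq_or_lt with h | h
    · rw [h, phase_zero] at hxy
      have : 0 < y ^ 2 := by have := hy.ne; positivity
      linarith
    · exact h
  have hx1 : -1 < x := hsub hx
  refine ⟨x, ⟨hx1, hx0⟩, ?_⟩
  rw [phaseCoord_eq_neg_sqrt hx1 hx0, hxy, ← neg_sq, Real.sqrt_sq (by linarith), neg_neg]

/-- The formal Lagrange inversion makes the left side `x^N` times an analytic germ. Near `0`, `x` is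
comparable to `s`, and `s'` is bounded away from zero. -/
theorem exists_bound_near_zero (N : ℕ) : ∃ C : ℝ, ∀ᶠ x in 𝓝 (0 : ℝ),
    |1 - ∑ n ∈ Finset.range N, 2 * laplaceCoeff n * (phaseCoord x ^ n * phaseCoordDeriv x)| ≤
      C * (|phaseCoord x| ^ N * phaseCoordDeriv x) := by
  have hp0 : phaseRoot 0 ≠ 0 := (phaseRoot_pos (by norm_num)).ne'
  have hp := analyticAt_phaseRoot
  have hpi := hp.fun_inv hp0
  have hx : AnalyticAt ℝ (fun x : ℝ => x) 0 := by fun_prop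
  have h1 : AnalyticAt ℝ (fun x : ℝ => 1 + x) 0 := by fun_prop
  have h1i : AnalyticAt ℝ (fun x : ℝ => (1 + x)⁻¹) 0 := h1.fun_inv (by norm_num)
  have ht : ∀ n : ℕ, AnalyticAt ℝ
      (fun x => (x * (phaseRoot x)⁻¹) ^ n * (phaseRoot x * (1 + x)⁻¹)) 0 :=
    fun n => ((hx.fun_mul hpi).fun_pow n).fun_mul (hp.fun_mul h1i)
  have hct : ∀ n : ℕ, AnalyticAt ℝ (fun x => laplaceCoeff n *
      ((x * (phaseRoot x)⁻¹) ^ n * (phaseRoot x * (1 + x)⁻¹))) 0 :=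
    fun n => analyticAt_const.fun_mul (ht n)
  have hs := Finset.analyticAt_fun_sum (Finset.range N) fun n _ => hct n
  have hD : X ^ N ∣ taylorSeries fun x => 1 - ∑ n ∈ Finset.range N, laplaceCoeff n *
      ((x * (phaseRoot x)⁻¹) ^ n * (phaseRoot x * (1 + x)⁻¹)) := by
    rw [taylorSeries_sub analyticAt_const hs, taylorSeries_const, map_one,
      taylorSeries_sum _ fun n _ => hct n]
    convert isPhaseSeries_taylorSeries.X_pow_dvd_one_sub N using 3 with n _
    rw [taylorSeries_mul analyticAt_const (ht n), taylorSeries_const,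
      taylorSeries_mul ((hx.fun_mul hpi).fun_pow n) (hp.fun_mul h1i),
      taylorSeries_pow (hx.fun_mul hpi), taylorSeries_mul hx hpi, taylorSeries_mul hp h1i,
      taylorSeries_inv hp hp0, taylorSeries_inv h1 (by norm_num), taylorSeries_id,
      taylorSeries_const_add_id, map_one, laplaceCoeff_eq]
    rfl
  obtain ⟨g, hg, hfg⟩ := exists_eventually_eq_pow_mul (analyticAt_const.fun_sub hs) hD
  have hcont : ContinuousAt (fun x => |g x| * phaseRoot x ^ N / phaseCoordDeriv x) 0 := by
    refine ContinuousAt.div (hg.continuousAt.abs.mul (hp.continuousAt.pow N)) ?_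
      (phaseCoordDeriv_pos (by norm_num)).ne'
    exact hp.continuousAt.div (by fun_prop) (by norm_num)
  refine ⟨|g 0| * phaseRoot 0 ^ N / phaseCoordDeriv 0 + 1, ?_⟩
  filter_upwards [hfg, hcont.eventually_lt_const (lt_add_one _),
    lt_mem_nhds (show (-1 : ℝ) < 0 by norm_num)] with x hx1 hx2 hx3
  have hr := phaseRoot_pos hx3
  have hd := phaseCoordDeriv_pos hx3
  have e1 : ∀ n, 2 * laplaceCoeff n * (phaseCoord x ^ n * phaseCoordDeriv x) =
      laplaceCoeff n * ((x * (phaseRoot x)⁻¹) ^ n * (phaseRoot x * (1 + x)⁻¹)) := by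
    intro n
    have : 1 + x ≠ 0 := by linarith
    rw [phaseCoord, phaseCoordDeriv, ← div_eq_mul_inv]
    field_simp
  simp only [e1]
  rw [hx1, abs_mul, abs_pow]
  have e2 : |x| = |phaseCoord x| * phaseRoot x := by
    rw [phaseCoord, abs_div, abs_of_pos hr]
    field_simp
  rw [div_lt_iff₀ hd] at hx2
  rw [e2, mul_pow]
  have h4 : 0 ≤ |phaseCoord x| ^ N := by positivity
  calc |phaseCoord x| ^ N * phaseRoot x ^ N * |g x|
      = |phaseCoord x| ^ N * (|g x| * phaseRoot x ^ N) := by ring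
    _ ≤ |phaseCoord x| ^ N * ((|g 0| * phaseRoot 0 ^ N / phaseCoordDeriv 0 + 1) *
        phaseCoordDeriv x) := mul_le_mul_of_nonneg_left hx2.le h4
    _ = _ := by ring

/-- Away from `0`, `|s|` and `|s| s' = |x|/(2(1+x))` are both bounded below. The extra power `N + 1`
is needed because `s'` alone tends to `0` at infinity, so at `N = 0` the constant `1` is not
`O(s')`. -/
theorem exists_bound_of_le_abs (N : ℕ) {δ : ℝ} (hδ : 0 < δ) (hδ1 : δ < 1) :
    ∃ C : ℝ, ∀ x, -1 < x → δ ≤ |x| →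
    |1 - ∑ n ∈ Finset.range N, 2 * laplaceCoeff n * (phaseCoord x ^ n * phaseCoordDeriv x)| ≤
      C * ((|phaseCoord x| ^ N + |phaseCoord x| ^ (N + 1)) * phaseCoordDeriv x) := by
  set s₀ := min (phaseCoord δ) (-phaseCoord (-δ)) with hs₀
  have hs₀pos : 0 < s₀ := lt_min (phaseCoord_pos hδ)
    (neg_pos.2 (phaseCoord_neg (by linarith) (by linarith)))
  set b := δ / (2 * (1 + δ)) with hb
  have hbpos : 0 < b := by positivity
  refine ⟨1 / (b * s₀ ^ N) + ∑ n ∈ Finset.range N, |2 * laplaceCoeff n| / s₀ ^ (N - n), ?_⟩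
  intro x hx hxδ
  have hd := phaseCoordDeriv_pos hx
  have h1x : 0 < 1 + x := by linarith
  have hs : s₀ ≤ |phaseCoord x| := by
    rcases le_or_gt 0 x with h | h
    · rw [abs_of_nonneg h] at hxδ
      refine (min_le_left _ _).trans (le_trans ?_ (le_abs_self _))
      exact strictMonoOn_phaseCoord_Ioi.monotoneOn hδ (by simp only [Set.mem_Ioi]; linarith) hxδ
    · rw [abs_of_neg h] at hxδ
      refine (min_le_right _ _).trans (le_trans ?_ (neg_le_abs _))
      exact neg_le_neg (strictMonoOn_phaseCoord_Ioo.monotoneOn ⟨hx, h⟩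
        ⟨by linarith, by linarith⟩ (by linarith))
  have hbs : b ≤ |phaseCoord x| * phaseCoordDeriv x := by
    have : |phaseCoord x| * phaseCoordDeriv x = |x| / (2 * (1 + x)) := by
      rw [← abs_of_pos hd, ← abs_mul, phaseCoord_mul_deriv hx, abs_div,
        abs_of_pos (show 0 < 2 * (1 + x) by linarith)]
    rw [this, hb, div_le_div_iff₀ (by positivity) (by positivity)]
    rcases le_or_gt 0 x with h | h
    · rw [abs_of_nonneg h] at hxδ ⊢
      nlinarith
    · rw [abs_of_neg h] at hxδ ⊢
      nlinarith
  set u := |phaseCoord x| with hu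
  set d := phaseCoordDeriv x with hdd
  have hu0 : 0 < u := hs₀pos.trans_le hs
  have hone : 1 ≤ 1 / (b * s₀ ^ N) * (u ^ (N + 1) * d) := by
    rw [one_div_mul_eq_div, one_le_div (by positivity), pow_succ]
    calc b * s₀ ^ N ≤ (u * d) * u ^ N :=
          mul_le_mul hbs (pow_le_pow_left₀ hs₀pos.le hs N) (by positivity) (by positivity)
      _ = _ := by ring
  have hterm : ∀ n ∈ Finset.range N, |2 * laplaceCoeff n * (phaseCoord x ^ n * d)| ≤
      |2 * laplaceCoeff n| / s₀ ^ (N - n) * (u ^ N * d) := by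
    intro n hn
    have hn' : n < N := Finset.mem_range.1 hn
    rw [abs_mul, abs_mul (_ ^ n), abs_pow, abs_of_pos hd, ← hu, div_mul_eq_mul_div,
      le_div_iff₀ (by positivity), mul_assoc]
    refine mul_le_mul_of_nonneg_left ?_ (abs_nonneg _)
    calc u ^ n * d * s₀ ^ (N - n) ≤ u ^ n * d * u ^ (N - n) :=
          mul_le_mul_of_nonneg_left (pow_le_pow_left₀ hs₀pos.le hs _) (by positivity)
      _ = u ^ (n + (N - n)) * d := by rw [pow_add]; ring
      _ = u ^ N * d := by rw [Nat.add_sub_cancel' hn'.le]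
  have hsum := (Finset.abs_sum_le_sum_abs _ _).trans (Finset.sum_le_sum hterm)
  rw [← Finset.sum_mul] at hsum
  have h3 := abs_sub (1 : ℝ)
    (∑ n ∈ Finset.range N, 2 * laplaceCoeff n * (phaseCoord x ^ n * d))
  rw [abs_one] at h3
  set S := ∑ n ∈ Finset.range N, |2 * laplaceCoeff n| / s₀ ^ (N - n)
  have hS : 0 ≤ S := Finset.sum_nonneg fun n _ => by positivity
  have hK : 0 ≤ 1 / (b * s₀ ^ N) := by positivity
  have h4 : 0 ≤ 1 / (b * s₀ ^ N) * (u ^ N * d) := by positivity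
  have h5 : 0 ≤ S * (u ^ (N + 1) * d) := by positivity
  calc _ ≤ 1 + S * (u ^ N * d) := h3.trans (by linarith)
    _ ≤ 1 / (b * s₀ ^ N) * (u ^ (N + 1) * d) + S * (u ^ N * d)
        + 1 / (b * s₀ ^ N) * (u ^ N * d) + S * (u ^ (N + 1) * d) := by linarith
    _ = _ := by ring

theorem exists_bound (N : ℕ) : ∃ C : ℝ, 0 ≤ C ∧ ∀ x, -1 < x →
    |1 - ∑ n ∈ Finset.range N, 2 * laplaceCoeff n * (phaseCoord x ^ n * phaseCoordDeriv x)| ≤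
      C * ((|phaseCoord x| ^ N + |phaseCoord x| ^ (N + 1)) * phaseCoordDeriv x) := by
  obtain ⟨C₁, h₁⟩ := exists_bound_near_zero N
  obtain ⟨ε, hε, hball⟩ := Metric.eventually_nhds_iff.1 h₁
  obtain ⟨C₂, h₂⟩ := exists_bound_of_le_abs N (δ := min ε (1 / 2)) (lt_min hε (by norm_num))
    (lt_of_le_of_lt (min_le_right _ _) (by norm_num))
  refine ⟨|C₁| + |C₂|, by positivity, fun x hx => ?_⟩
  have hd := phaseCoordDeriv_pos hx
  have hA : 0 ≤ |phaseCoord x| ^ N * phaseCoordDeriv x := by positivity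
  have hB : 0 ≤ |phaseCoord x| ^ (N + 1) * phaseCoordDeriv x := by positivity
  have hC1 := le_abs_self C₁
  have hC2 := le_abs_self C₂
  have p1 := abs_nonneg C₁
  have p2 := abs_nonneg C₂
  rw [add_mul]
  rcases lt_or_ge |x| (min ε (1 / 2)) with h | h
  · refine (hball (y := x) ?_).trans ?_
    · rw [Real.dist_eq, sub_zero]; exact h.trans_le (min_le_left _ _)
    · nlinarith
  · refine (h₂ x hx h).trans ?_
    rw [add_mul]
    nlinarith

end Coordinate

/-! ### Laplace's method on each side of the critical point, and the gamma integrals. -/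

section Laplace

theorem integrableOn_pow_mul_exp_Ioi {l : ℝ} (hl : 0 < l) (n : ℕ) :
    IntegrableOn (fun u : ℝ => u ^ n * Real.exp (-l * u ^ 2)) (Set.Ioi 0) := by
  have := integrableOn_rpow_mul_exp_neg_mul_sq hl (s := n)
    (lt_of_lt_of_le (by norm_num) n.cast_nonneg)
  simpa only [Real.rpow_natCast] using this

theorem integral_pow_mul_exp_Ioi {l : ℝ} (hl : 0 < l) (n : ℕ) :
    ∫ u in Set.Ioi (0 : ℝ), u ^ n * Real.exp (-l * u ^ 2) =
      Real.Gamma (((n : ℝ) + 1) / 2) / 2 * (1 / l ^ (((n : ℝ) + 1) / 2)) := by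
  have := integral_rpow_mul_exp_neg_mul_rpow (p := 2) (q := n) two_pos
    (lt_of_lt_of_le (by norm_num) n.cast_nonneg) hl
  simp only [Real.rpow_natCast, Real.rpow_two] at this
  rw [this, neg_div, Real.rpow_neg hl.le]
  ring

theorem integrableOn_pow_mul_exp_Iio {l : ℝ} (hl : 0 < l) (n : ℕ) :
    IntegrableOn (fun u : ℝ => u ^ n * Real.exp (-l * u ^ 2)) (Set.Iio 0) := by
  have h := (integrableOn_pow_mul_exp_Ioi hl n).const_mul ((-1) ^ n)
  rw [← neg_zero] at h
  have h2 := IntegrableOn.comp_neg_Iio (f := fun u : ℝ => (-1) ^ n * (u ^ n *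
    Real.exp (-l * u ^ 2))) h
  refine h2.congr_fun (fun u _ => ?_) measurableSet_Iio
  simp only [neg_sq]
  rw [← mul_assoc, ← mul_pow]
  simp

theorem integral_pow_mul_exp_Iio {l : ℝ} (hl : 0 < l) (n : ℕ) :
    ∫ u in Set.Iio (0 : ℝ), u ^ n * Real.exp (-l * u ^ 2) =
      (-1) ^ n * (Real.Gamma (((n : ℝ) + 1) / 2) / 2 * (1 / l ^ (((n : ℝ) + 1) / 2))) := by
  rw [← integral_pow_mul_exp_Ioi hl, ← integral_const_mul, ← integral_Iic_eq_integral_Iio]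
  have := integral_comp_neg_Iic 0 (fun u : ℝ => (-1) ^ n * (u ^ n * Real.exp (-l * u ^ 2)))
  rw [neg_zero] at this
  rw [← this]
  refine setIntegral_congr_fun measurableSet_Iic fun u _ => ?_
  simp only [neg_sq]
  rw [← mul_assoc, ← mul_pow]
  simp

/-- A side `A` of the critical point `0` of the phase, on which the sign of the coordinate
`phaseCoord` is `e`, together with the exact values of the basic Laplace integrals. -/
structure IsLaplaceSide (A : Set ℝ) (e : ℝ) : Prop where
  measurableSet : MeasurableSet A
  sq_eq_one : e ^ 2 = 1
  neg_one_lt : ∀ x ∈ A, -1 < x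
  abs_eq : ∀ x ∈ A, |phaseCoord x| = e * phaseCoord x
  integrableOn : ∀ l : ℝ, 0 < l → ∀ n : ℕ, IntegrableOn
    (fun x => phaseCoord x ^ n * phaseCoordDeriv x * Real.exp (-l * phase x)) A
  integral_eq : ∀ l : ℝ, 0 < l → ∀ n : ℕ,
    ∫ x in A, phaseCoord x ^ n * phaseCoordDeriv x * Real.exp (-l * phase x) =
      e ^ n * (Real.Gamma (((n : ℝ) + 1) / 2) / 2 * (1 / l ^ (((n : ℝ) + 1) / 2)))

theorem abs_deriv_smul_eq {A : Set ℝ} (hA : ∀ x ∈ A, -1 < x) (l : ℝ) (n : ℕ) :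
    Set.EqOn (fun x => |phaseCoordDeriv x| • (phaseCoord x ^ n * Real.exp (-l * phaseCoord x ^ 2)))
      (fun x => phaseCoord x ^ n * phaseCoordDeriv x * Real.exp (-l * phase x)) A := by
  intro x hx
  simp only [smul_eq_mul]
  rw [abs_of_pos (phaseCoordDeriv_pos (hA x hx)), phaseCoord_sq (hA x hx)]
  ring

theorem isLaplaceSide_Ioi : IsLaplaceSide (Set.Ioi 0) 1 := by
  have hA : ∀ x ∈ Set.Ioi (0 : ℝ), -1 < x := fun x (hx : 0 < x) => by linarith
  have hd : ∀ x ∈ Set.Ioi (0 : ℝ),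
      HasDerivWithinAt phaseCoord (phaseCoordDeriv x) (Set.Ioi 0) x :=
    fun x hx => (hasDerivAt_phaseCoord (hA x hx) (ne_of_gt hx)).hasDerivWithinAt
  have hi := strictMonoOn_phaseCoord_Ioi.injOn
  refine ⟨measurableSet_Ioi, by norm_num, hA, fun x hx => ?_, fun l hl n => ?_, fun l hl n => ?_⟩
  · rw [one_mul, abs_of_pos (phaseCoord_pos hx)]
  · have h := integrableOn_pow_mul_exp_Ioi hl n
    rw [← image_phaseCoord_Ioi,
      integrableOn_image_iff_integrableOn_abs_deriv_smul measurableSet_Ioi hd hi] at h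
    exact h.congr_fun (abs_deriv_smul_eq hA l n) measurableSet_Ioi
  · have h := integral_image_eq_integral_abs_deriv_smul measurableSet_Ioi hd hi
      (fun u : ℝ => u ^ n * Real.exp (-l * u ^ 2))
    rw [image_phaseCoord_Ioi, integral_pow_mul_exp_Ioi hl,
      setIntegral_congr_fun measurableSet_Ioi (abs_deriv_smul_eq hA l n)] at h
    rw [← h, one_pow, one_mul]

theorem isLaplaceSide_Ioo : IsLaplaceSide (Set.Ioo (-1) 0) (-1) := by
  have hA : ∀ x ∈ Set.Ioo (-1 : ℝ) 0, -1 < x := fun x hx => hx.1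
  have hd : ∀ x ∈ Set.Ioo (-1 : ℝ) 0,
      HasDerivWithinAt phaseCoord (phaseCoordDeriv x) (Set.Ioo (-1) 0) x :=
    fun x hx => (hasDerivAt_phaseCoord (hA x hx) (ne_of_lt hx.2)).hasDerivWithinAt
  have hi := strictMonoOn_phaseCoord_Ioo.injOn
  refine ⟨measurableSet_Ioo, by norm_num, hA, fun x hx => ?_, fun l hl n => ?_, fun l hl n => ?_⟩
  · rw [neg_one_mul, abs_of_neg (phaseCoord_neg hx.1 hx.2)]
  · have h := integrableOn_pow_mul_exp_Iio hl n
    rw [← image_phaseCoord_Ioo,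
      integrableOn_image_iff_integrableOn_abs_deriv_smul measurableSet_Ioo hd hi] at h
    exact h.congr_fun (abs_deriv_smul_eq hA l n) measurableSet_Ioo
  · have h := integral_image_eq_integral_abs_deriv_smul measurableSet_Ioo hd hi
      (fun u : ℝ => u ^ n * Real.exp (-l * u ^ 2))
    rw [image_phaseCoord_Ioo, integral_pow_mul_exp_Iio hl,
      setIntegral_congr_fun measurableSet_Ioo (abs_deriv_smul_eq hA l n)] at h
    rw [← h]

theorem measurable_phase : Measurable phase :=
  measurable_id.sub (Real.measurable_log.comp (measurable_const.add measurable_id))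

namespace IsLaplaceSide

variable {A : Set ℝ} {e : ℝ}

theorem abs_pow_mul_eq (h : IsLaplaceSide A e) (l : ℝ) (n : ℕ) :
    Set.EqOn (fun x => e ^ n * (phaseCoord x ^ n * phaseCoordDeriv x * Real.exp (-l * phase x)))
      (fun x => |phaseCoord x| ^ n * phaseCoordDeriv x * Real.exp (-l * phase x)) A := by
  intro x hx
  simp only
  rw [h.abs_eq x hx, mul_pow]
  ring

theorem integrableOn_abs (h : IsLaplaceSide A e) {l : ℝ} (hl : 0 < l) (n : ℕ) : IntegrableOn
    (fun x => |phaseCoord x| ^ n * phaseCoordDeriv x * Real.exp (-l * phase x)) A :=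
  IntegrableOn.congr_fun ((h.integrableOn l hl n).const_mul (e ^ n)) (h.abs_pow_mul_eq l n)
    h.measurableSet

theorem integral_abs_eq (h : IsLaplaceSide A e) {l : ℝ} (hl : 0 < l) (n : ℕ) :
    ∫ x in A, |phaseCoord x| ^ n * phaseCoordDeriv x * Real.exp (-l * phase x) =
      Real.Gamma (((n : ℝ) + 1) / 2) / 2 * (1 / l ^ (((n : ℝ) + 1) / 2)) := by
  rw [← setIntegral_congr_fun h.measurableSet (h.abs_pow_mul_eq l n), integral_const_mul,
    h.integral_eq l hl, ← mul_assoc, ← mul_pow, ← pow_two, h.sq_eq_one, one_pow, one_mul]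

theorem integrableOn_exp (h : IsLaplaceSide A e) {l : ℝ} (hl : 0 < l) :
    IntegrableOn (fun x => Real.exp (-l * phase x)) A := by
  -- With no terms subtracted the bound reads `1 ≤ C (1 + |s|) s'`, which dominates the integrand by
  -- exactly integrable functions.
  obtain ⟨C, -, hC⟩ := exists_bound 0
  refine Integrable.mono' (((h.integrableOn_abs hl 0).add (h.integrableOn_abs hl 1)).const_mul C)
    (by
      refine Measurable.aestronglyMeasurable ?_
      exact Real.measurable_exp.comp (measurable_phase.const_mul (-l))) ?_
  filter_upwards [ae_restrict_mem h.measurableSet] with x hx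
  have h1 := hC x (h.neg_one_lt x hx)
  rw [Finset.range_zero, Finset.sum_empty, sub_zero, abs_one] at h1
  have h2 := mul_le_mul_of_nonneg_right h1 (Real.exp_pos (-l * phase x)).le
  rw [Real.norm_eq_abs, Real.abs_exp]
  refine (one_mul (Real.exp (-l * phase x))).symm.le.trans (h2.trans (le_of_eq ?_))
  simp only [Pi.add_apply]
  ring

/-- The pointwise bound is integrated against `exp(-l f)`, every term becoming a Gaussian moment in
`s`. The second power on the right comes from `|s|^(N+1)` and is the smaller one for `l ≥ 1`. -/
theorem abs_sub_le (h : IsLaplaceSide A e) (N : ℕ) : ∃ C : ℝ, 0 ≤ C ∧ ∀ l : ℝ, 0 < l →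
    |(∫ x in A, Real.exp (-l * phase x)) - ∑ n ∈ Finset.range N,
      e ^ n * (Real.Gamma (((n : ℝ) + 1) / 2) * laplaceCoeff n) * (1 / l ^ (((n : ℝ) + 1) / 2))| ≤
    C * (1 / l ^ (((N : ℝ) + 1) / 2) + 1 / l ^ ((((N + 1 : ℕ) : ℝ) + 1) / 2)) := by
  obtain ⟨C, hC0, hC⟩ := exists_bound N
  have hG : ∀ n : ℕ, 0 < Real.Gamma (((n : ℝ) + 1) / 2) := fun n =>
    Real.Gamma_pos_of_pos (by positivity)
  refine ⟨C * (Real.Gamma (((N : ℝ) + 1) / 2) / 2 +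
    Real.Gamma ((((N + 1 : ℕ) : ℝ) + 1) / 2) / 2), ?_, fun l hl => ?_⟩
  · have := hG N
    have := hG (N + 1)
    positivity
  have hterm : ∀ n ∈ Finset.range N, IntegrableOn (fun x => 2 * laplaceCoeff n *
      (phaseCoord x ^ n * phaseCoordDeriv x * Real.exp (-l * phase x))) A :=
    fun n _ => (h.integrableOn l hl n).const_mul _
  have hsum : ∑ n ∈ Finset.range N, e ^ n * (Real.Gamma (((n : ℝ) + 1) / 2) * laplaceCoeff n) *
      (1 / l ^ (((n : ℝ) + 1) / 2)) = ∫ x in A, ∑ n ∈ Finset.range N, 2 * laplaceCoeff n *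
      (phaseCoord x ^ n * phaseCoordDeriv x * Real.exp (-l * phase x)) := by
    rw [integral_finsetSum _ hterm]
    refine Finset.sum_congr rfl fun n _ => ?_
    rw [integral_const_mul, h.integral_eq l hl]
    ring
  have hN := h.integrableOn_abs hl N
  have hN1 := h.integrableOn_abs hl (N + 1)
  have hbound : ∀ᵐ x ∂(volume.restrict A), ‖Real.exp (-l * phase x) - ∑ n ∈ Finset.range N,
      2 * laplaceCoeff n * (phaseCoord x ^ n * phaseCoordDeriv x * Real.exp (-l * phase x))‖ ≤
      C * (|phaseCoord x| ^ N * phaseCoordDeriv x * Real.exp (-l * phase x) +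
        |phaseCoord x| ^ (N + 1) * phaseCoordDeriv x * Real.exp (-l * phase x)) := by
    filter_upwards [ae_restrict_mem h.measurableSet] with x hx
    have h1 := mul_le_mul_of_nonneg_right (hC x (h.neg_one_lt x hx))
      (Real.exp_pos (-l * phase x)).le
    rw [Real.norm_eq_abs]
    calc _ = |(1 - ∑ n ∈ Finset.range N,
          2 * laplaceCoeff n * (phaseCoord x ^ n * phaseCoordDeriv x)) *
          Real.exp (-l * phase x)| := by
          rw [sub_mul, one_mul, Finset.sum_mul]
          congr 2
          refine Finset.sum_congr rfl fun n _ => ?_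
          ring
      _ = _ := by rw [abs_mul, Real.abs_exp]
      _ ≤ _ := h1
      _ = _ := by ring
  rw [hsum, ← integral_sub (h.integrableOn_exp hl) (integrable_finsetSum _ hterm),
    ← Real.norm_eq_abs]
  refine (norm_integral_le_of_norm_le ((hN.add hN1).const_mul C) hbound).trans ?_
  simp only [Pi.add_apply]
  rw [integral_const_mul, integral_add hN hN1, h.integral_abs_eq hl, h.integral_abs_eq hl]
  have g1 := (hG N).le
  have g2 := (hG (N + 1)).le
  have p1 : 0 ≤ 1 / l ^ (((N : ℝ) + 1) / 2) := by positivity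
  have p2 : 0 ≤ 1 / l ^ ((((N + 1 : ℕ) : ℝ) + 1) / 2) := by positivity
  rw [mul_assoc]
  refine mul_le_mul_of_nonneg_left ?_ hC0
  nlinarith [mul_nonneg g1 p2, mul_nonneg g2 p1]

/-- Laplace's method on one side of the critical point. -/
theorem isBigO (h : IsLaplaceSide A e) (N : ℕ) :
    (fun l : ℝ => (∫ x in A, Real.exp (-l * phase x)) - ∑ n ∈ Finset.range N,
      e ^ n * (Real.Gamma (((n : ℝ) + 1) / 2) * laplaceCoeff n) * (1 / l ^ (((n : ℝ) + 1) / 2)))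
    =O[atTop] fun l : ℝ => 1 / l ^ (((N : ℝ) + 1) / 2) := by
  obtain ⟨C, hC0, hC⟩ := h.abs_sub_le N
  refine IsBigO.of_bound (C * 2) ?_
  filter_upwards [eventually_ge_atTop (1 : ℝ)] with l hl
  have hl0 : 0 < l := by linarith
  rw [Real.norm_eq_abs, Real.norm_eq_abs, abs_of_nonneg (a := 1 / l ^ (((N : ℝ) + 1) / 2))
    (by positivity)]
  refine (hC l hl0).trans ?_
  rw [mul_assoc]
  refine mul_le_mul_of_nonneg_left ?_ hC0
  have : 1 / l ^ ((((N + 1 : ℕ) : ℝ) + 1) / 2) ≤ 1 / l ^ (((N : ℝ) + 1) / 2) := by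
    refine one_div_le_one_div_of_le (by positivity) ?_
    exact Real.rpow_le_rpow_of_exponent_le hl (by push_cast; linarith)
  linarith

end IsLaplaceSide

theorem hasAsymptoticExpansion_laplace :
    HasAsymptoticExpansion
      (fun l : ℝ => ∫ x in Set.Ioi (0 : ℝ), Real.exp (-l * phase x))
      (fun n l => 1 / l ^ (((n : ℝ) + 1) / 2))
      (fun n => Real.Gamma (((n : ℝ) + 1) / 2) * laplaceCoeff n) := by
  intro N
  simpa only [one_pow, one_mul] using isLaplaceSide_Ioi.isBigO N

/-- The Laplace integral over `(0, ∞)`. -/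
noncomputable def laplaceRight (l : ℝ) : ℝ := ∫ x in Set.Ioi (0 : ℝ), Real.exp (-l * phase x)

/-- The Laplace integral over `(-1, 0)`. -/
noncomputable def laplaceLeft (l : ℝ) : ℝ := ∫ x in Set.Ioo (-1 : ℝ) 0, Real.exp (-l * phase x)

theorem image_mul_one_add {a : ℝ} (ha : 0 < a) (c : ℝ) :
    (fun x => a * (1 + x)) '' Set.Ioi c = Set.Ioi (a * (1 + c)) := by
  ext y
  simp only [Set.mem_image, Set.mem_Ioi]
  constructor
  · rintro ⟨x, hx, rfl⟩
    exact mul_lt_mul_of_pos_left (by linarith) ha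
  · intro hy
    refine ⟨y / a - 1, ?_, by field_simp; ring⟩
    rw [lt_sub_iff_add_lt, lt_div_iff₀ ha]
    linarith

theorem integral_exp_mul_rpow_Ioi {a : ℝ} (ha : 0 < a) (b c : ℝ) :
    ∫ t in Set.Ioi (a * (1 + c)), Real.exp (-t) * t ^ b =
      ∫ x in Set.Ioi c, a * (Real.exp (-(a * (1 + x))) * (a * (1 + x)) ^ b) := by
  have h := integral_image_eq_integral_abs_deriv_smul (s := Set.Ioi c)
    (f := fun x => a * (1 + x)) (f' := fun _ => a) measurableSet_Ioi
    (fun x _ => by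
      simpa using (((hasDerivAt_id x).const_add 1).const_mul a).hasDerivWithinAt)
    (fun x _ y _ hxy => by
      have := mul_left_cancel₀ ha.ne' hxy
      linarith)
    (fun t => Real.exp (-t) * t ^ b)
  rw [image_mul_one_add ha, abs_of_pos ha] at h
  exact h

theorem exp_mul_rpow_eq {a x : ℝ} (ha : 0 < a) (hx : -1 < x) :
    Real.exp (-(a * (1 + x))) * (a * (1 + x)) ^ a =
      a ^ a * Real.exp (-a) * Real.exp (-a * phase x) := by
  have h1 : 0 < 1 + x := by linarith
  rw [Real.mul_rpow ha.le h1.le, Real.rpow_def_of_pos h1, phase]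
  rw [show Real.exp (-(a * (1 + x))) * (a ^ a * Real.exp (Real.log (1 + x) * a)) =
    a ^ a * (Real.exp (-(a * (1 + x))) * Real.exp (Real.log (1 + x) * a)) by ring,
    mul_assoc, ← Real.exp_add, ← Real.exp_add]
  congr 2
  ring

/-- Substituting `t = a(1+x)` in the integral for `Γ(a+1)`, rather than `Γ(a)`, leaves no factor
`1/(1+x)`. -/
theorem Gamma_eq_laplace {a : ℝ} (ha : 0 < a) :
    Real.Gamma a = a ^ a * Real.exp (-a) * (laplaceRight a + laplaceLeft a) := by
  have h1 : Real.Gamma (a + 1) = a * (a ^ a * Real.exp (-a)) *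
      ∫ x in Set.Ioi (-1 : ℝ), Real.exp (-a * phase x) := by
    rw [Real.Gamma_eq_integral (by positivity), ← integral_const_mul]
    have h2 := integral_exp_mul_rpow_Ioi ha a (-1)
    rw [add_neg_cancel, mul_zero] at h2
    rw [add_sub_cancel_right, h2]
    refine setIntegral_congr_fun measurableSet_Ioi fun x hx => ?_
    rw [exp_mul_rpow_eq ha hx]
    ring
  have h3 : ∫ x in Set.Ioi (-1 : ℝ), Real.exp (-a * phase x) =
      laplaceRight a + laplaceLeft a := by
    have hu : Set.Ioi (-1 : ℝ) = Set.Ioc (-1) 0 ∪ Set.Ioi 0 :=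
      (Set.Ioc_union_Ioi_eq_Ioi (by norm_num)).symm
    have hi : IntegrableOn (fun x => Real.exp (-a * phase x)) (Set.Ioc (-1) 0) :=
      (integrableOn_Ioc_iff_integrableOn_Ioo (by simp)).2
        (isLaplaceSide_Ioo.integrableOn_exp ha)
    rw [hu, setIntegral_union (Set.Ioc_disjoint_Ioi le_rfl) measurableSet_Ioi hi
      (isLaplaceSide_Ioi.integrableOn_exp ha), integral_Ioc_eq_integral_Ioo, add_comm]
    rfl
  rw [Real.Gamma_add_one ha.ne', h3] at h1
  have := mul_left_cancel₀ ha.ne' (h1.trans (mul_assoc _ _ _))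
  exact this

theorem incompleteGamma_eq_laplace {a : ℝ} (ha : 0 < a) :
    incompleteGamma a a = a ^ a * Real.exp (-a) * (laplaceRight a - 1 / a) := by
  -- Here the factor `1/(1+x) = 1 - x/(1+x)` does remain; `x/(1+x) = 2 s s'` integrates exactly to
  -- `1/a`.
  have h1 : incompleteGamma a a = a ^ a * Real.exp (-a) *
      ∫ x in Set.Ioi (0 : ℝ), (Real.exp (-a * phase x) -
        2 * (phaseCoord x ^ 1 * phaseCoordDeriv x * Real.exp (-a * phase x))) := by
    have h2 := integral_exp_mul_rpow_Ioi ha (a - 1) 0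
    rw [add_zero, mul_one] at h2
    rw [incompleteGamma, h2, ← integral_const_mul]
    refine setIntegral_congr_fun measurableSet_Ioi fun x (hx : 0 < x) => ?_
    have hx1 : 0 < 1 + x := by linarith
    rw [Real.rpow_sub_one (by positivity), pow_one, phaseCoord_mul_deriv (by linarith),
      ← mul_div_assoc, exp_mul_rpow_eq ha (by linarith)]
    field_simp
    ring
  rw [h1, integral_sub (isLaplaceSide_Ioi.integrableOn_exp ha)
    ((isLaplaceSide_Ioi.integrableOn a ha 1).const_mul 2), integral_const_mul,
    isLaplaceSide_Ioi.integral_eq a ha]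
  congr 2
  norm_num
  ring

end Laplace

/-! ### Algebra and uniqueness of expansions in inverse powers. -/

section AsymptoticPowerSeries

/-- Asymptotic expansion in inverse powers of the variable. -/
def HasInvPowExpansion (F : ℝ → ℝ) (c : ℕ → ℝ) : Prop :=
  HasAsymptoticExpansion F (fun n a => 1 / a ^ n) c

namespace HasInvPowExpansion

variable {U V : ℝ → ℝ} {u v : ℕ → ℝ}

theorem isBigO_one (h : HasInvPowExpansion U u) : U =O[atTop] fun _ : ℝ => (1 : ℝ) := by
  simpa using h 0

theorem shift (h : HasInvPowExpansion U u) :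
    HasInvPowExpansion (fun a => a * (U a - u 0)) fun n => u (n + 1) := by
  intro N
  have h1 := (isBigO_refl (fun a : ℝ => a) atTop).mul (h (N + 1))
  refine h1.congr' ?_ ?_
  · filter_upwards [eventually_gt_atTop (0 : ℝ)] with a ha
    rw [Finset.sum_range_succ', mul_sub, mul_add, Finset.mul_sum]
    have : ∀ n, a * (u (n + 1) * (1 / a ^ (n + 1))) = u (n + 1) * (1 / a ^ n) := fun n => by
      field_simp
      ring
    simp only [this]
    simp
    ring
  · filter_upwards [eventually_gt_atTop (0 : ℝ)] with a ha
    field_simp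
    ring

theorem mul (hU : HasInvPowExpansion U u) (hV : HasInvPowExpansion V v) :
    HasInvPowExpansion (fun a => U a * V a)
      fun n => ∑ p ∈ Finset.HasAntidiagonal.antidiagonal n, u p.1 * v p.2 := by
  intro N
  induction N generalizing U u with
  | zero => simpa using hU.isBigO_one.mul hV.isBigO_one
  | succ N ih =>
    -- Peeling off the leading coefficient: `U V = u₀ V + a⁻¹ (a (U - u₀)) V`, where the shifted
    -- factor needs one order less.
    have h1 := (isBigO_refl (fun a : ℝ => 1 / a) atTop).mul (ih hU.shift)
    have h2 := (hV (N + 1)).const_mul_left (u 0)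
    have h1' : (fun a : ℝ => 1 / a * (a * (U a - u 0) * V a - ∑ n ∈ Finset.range N,
        (∑ p ∈ Finset.HasAntidiagonal.antidiagonal n, u (p.1 + 1) * v p.2) * (1 / a ^ n))) =O[atTop]
        fun a : ℝ => 1 / a ^ (N + 1) := by
      refine h1.congr' EventuallyEq.rfl ?_
      filter_upwards [eventually_gt_atTop (0 : ℝ)] with a ha
      field_simp
      ring
    refine (h1'.add h2).congr' ?_ EventuallyEq.rfl
    filter_upwards [eventually_gt_atTop (0 : ℝ)] with a ha
    rw [Finset.sum_range_succ', Finset.sum_range_succ']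
    simp only [Finset.Nat.sum_antidiagonal_succ, add_mul, Finset.sum_add_distrib,
      Finset.Nat.antidiagonal_zero, Finset.sum_singleton, mul_sub, mul_add, Finset.mul_sum]
    have e1 : 1 / a * (a * U a * V a) = U a * V a := by field_simp
    have e2 : ∀ n, 1 / a * ((∑ p ∈ Finset.HasAntidiagonal.antidiagonal n, u (p.1 + 1) * v p.2) * (1 / a ^ n)) =
        (∑ p ∈ Finset.HasAntidiagonal.antidiagonal n, u (p.1 + 1) * v p.2) * (1 / a ^ (n + 1)) := fun n => by
      field_simp
      ring
    simp only [e2, sub_mul]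
    have e3 : 1 / a * (a * U a * V a - a * u 0 * V a) = U a * V a - u 0 * V a := by
      field_simp
    rw [e3]
    have e4 : ∀ n, u 0 * (v (n + 1) * (1 / a ^ (n + 1))) =
      u 0 * v (n + 1) * (1 / a ^ (n + 1)) := fun n => by ring
    simp only [e4]
    ring

theorem of_sum (N : ℕ) (c : ℕ → ℝ) :
    HasInvPowExpansion (fun a => ∑ n ∈ Finset.range N, c n * (1 / a ^ n))
      fun n => if n < N then c n else 0 := by
  intro M
  have h1 : ∀ n ∈ Finset.range N, (fun a : ℝ => if n < M then 0 else c n * (1 / a ^ n)) =O[atTop]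
      fun a : ℝ => 1 / a ^ M := by
    intro n _
    split_ifs with hn
    · exact isBigO_zero _ _
    · refine IsBigO.const_mul_left ?_ _
      refine IsBigO.of_bound 1 ?_
      filter_upwards [eventually_ge_atTop (1 : ℝ)] with a ha
      have ha0 : 0 < a := by linarith
      rw [Real.norm_of_nonneg (by positivity), Real.norm_of_nonneg (by positivity), one_mul]
      exact one_div_le_one_div_of_le (by positivity) (pow_le_pow_right₀ ha (by omega))
  refine (IsBigO.fun_sum h1).congr_left fun a => ?_
  have h2 : ∑ n ∈ Finset.range M, (if n < N then c n else 0) * (1 / a ^ n) =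
      ∑ n ∈ Finset.range N, if n < M then c n * (1 / a ^ n) else 0 := by
    simp only [ite_mul, zero_mul]
    rw [← Finset.sum_filter, ← Finset.sum_filter]
    refine Finset.sum_congr ?_ fun _ _ => rfl
    ext n
    simp only [Finset.mem_filter, Finset.mem_range]
    tauto
  rw [h2, ← Finset.sum_sub_distrib]
  refine Finset.sum_congr rfl fun n _ => ?_
  split_ifs <;> simp

theorem tendsto (h : HasInvPowExpansion U u) : Tendsto U atTop (𝓝 (u 0)) := by
  have h1 := h 1
  simp only [Finset.range_one, Finset.sum_singleton, pow_zero, div_one, mul_one, pow_one] at h1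
  have h2 : Tendsto (fun a : ℝ => 1 / a) atTop (𝓝 0) := by
    simpa using tendsto_inv_atTop_zero (𝕜 := ℝ)
  have h3 := h1.trans_tendsto h2
  simpa using h3.add_const (u 0)

/-- For the partial sum `V_N` of the formal reciprocal, `U V_N = 1 + O(a^{-N})`. Multiplication by
the bounded function `U⁻¹` finishes. -/
theorem inv (h : HasInvPowExpansion U u) (h0 : u 0 * v 0 = 1)
    (hv : ∀ n, ∑ p ∈ Finset.HasAntidiagonal.antidiagonal (n + 1), u p.1 * v p.2 = 0) :
    HasInvPowExpansion (fun a => (U a)⁻¹) v := by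
  have hu0 : u 0 ≠ 0 := left_ne_zero_of_mul_eq_one h0
  have hinv : Tendsto (fun a => (U a)⁻¹) atTop (𝓝 (u 0)⁻¹) := h.tendsto.inv₀ hu0
  intro N
  rcases Nat.eq_zero_or_pos N with rfl | hN
  · simpa using hinv.isBigO_one ℝ
  have h1 := h.mul (of_sum N v) N
  have h2 : ∀ a : ℝ, ∑ n ∈ Finset.range N, (∑ p ∈ Finset.HasAntidiagonal.antidiagonal n,
      u p.1 * if p.2 < N then v p.2 else 0) * (1 / a ^ n) = 1 := by
    intro a
    rw [← Nat.sub_add_cancel hN, Finset.sum_range_succ']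
    have : ∀ n ∈ Finset.range (N - 1), (∑ p ∈ Finset.HasAntidiagonal.antidiagonal (n + 1),
        u p.1 * if p.2 < N - 1 + 1 then v p.2 else 0) * (1 / a ^ (n + 1)) = 0 := by
      intro n hn
      rw [← zero_mul (1 / a ^ (n + 1)), ← hv n]
      congr 1
      refine Finset.sum_congr rfl fun p hp => ?_
      have := Finset.HasAntidiagonal.mem_antidiagonal.1 hp
      have := Finset.mem_range.1 hn
      rw [if_pos (by omega)]
    rw [Finset.sum_eq_zero this]
    simp [h0]
  simp only [h2] at h1
  have h3 := ((hinv.isBigO_one ℝ).mul h1).neg_left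
  refine h3.congr' ?_ ?_
  · filter_upwards [h.tendsto.eventually_ne hu0] with a ha
    field_simp
    ring
  · filter_upwards with a
    rw [one_mul]

end HasInvPowExpansion

/-- Once the earlier coefficients vanish, the bound of order `n + 1` divided by the `n`-th scale
function says that the constant `d n` is `O(1/a)`. -/
theorem eq_zero_of_forall_isBigO {φ : ℝ → ℝ} (hφ : ∀ᶠ a in atTop, φ a ≠ 0) {d : ℕ → ℝ}
    (h : ∀ N : ℕ, (fun a : ℝ => ∑ n ∈ Finset.range N, d n * (φ a * (1 / a ^ n))) =O[atTop]
      fun a => φ a * (1 / a ^ N)) (n : ℕ) : d n = 0 := by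
  induction n using Nat.strong_induction_on with
  | _ n ih =>
    have h1 := h (n + 1)
    have h2 : (fun _ : ℝ => d n) =O[atTop] fun a : ℝ => a⁻¹ := by
      have h3 := (isBigO_refl (fun a : ℝ => (φ a)⁻¹ * a ^ n) atTop).mul h1
      refine h3.congr' ?_ ?_
      · filter_upwards [hφ, eventually_gt_atTop (0 : ℝ)] with a ha ha0
        rw [Finset.sum_range_succ, Finset.sum_eq_zero fun m hm => by
          rw [ih m (Finset.mem_range.1 hm), zero_mul]]
        field_simp
        ring
      · filter_upwards [hφ, eventually_gt_atTop (0 : ℝ)] with a ha ha0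
        field_simp
        ring
    exact tendsto_nhds_unique tendsto_const_nhds (h2.trans_tendsto tendsto_inv_atTop_zero)

theorem HasAsymptoticExpansion.unique {F φ : ℝ → ℝ} {c d : ℕ → ℝ}
    (hφ : ∀ᶠ a in atTop, φ a ≠ 0)
    (hc : HasAsymptoticExpansion F (fun n a => φ a * (1 / a ^ n)) c)
    (hd : HasAsymptoticExpansion F (fun n a => φ a * (1 / a ^ n)) d) : c = d := by
  funext n
  refine sub_eq_zero.1 (eq_zero_of_forall_isBigO (d := fun n => c n - d n) hφ (fun N => ?_) n)
  refine ((hd N).sub (hc N)).congr_left fun a => ?_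
  simp only [sub_mul, Finset.sum_sub_distrib]
  ring

end AsymptoticPowerSeries

/-! ### Stirling's series and the expansion of `Γ(a,a)/Γ(a)`. -/

section Gamma

theorem sum_range_two_mul (f : ℕ → ℝ) (N : ℕ) : ∑ n ∈ Finset.range (2 * N), f n =
    ∑ k ∈ Finset.range N, (f (2 * k) + f (2 * k + 1)) := by
  induction N with
  | zero => simp
  | succ N ih =>
    rw [Nat.mul_succ, Finset.sum_range_succ, Finset.sum_range_succ, ih, Finset.sum_range_succ]
    ring

theorem one_div_rpow_half (k : ℕ) {l : ℝ} (hl : 0 < l) :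
    1 / l ^ (((((2 * k : ℕ) : ℝ)) + 1) / 2) = 1 / Real.sqrt l * (1 / l ^ k) := by
  rw [show ((((2 * k : ℕ) : ℝ)) + 1) / 2 = 1 / 2 + (k : ℝ) by push_cast; ring,
    Real.rpow_add hl, Real.rpow_natCast, ← Real.sqrt_eq_rpow]
  field_simp

theorem one_div_rpow_odd (k : ℕ) (l : ℝ) :
    1 / l ^ (((((2 * k + 1 : ℕ) : ℝ)) + 1) / 2) = 1 / l ^ (k + 1) := by
  rw [show ((((2 * k + 1 : ℕ) : ℝ)) + 1) / 2 = ((k + 1 : ℕ) : ℝ) by push_cast; ring,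
    Real.rpow_natCast]

/-- The Laplace integral over `(-1, ∞)`, normalized so that it tends to `1`. -/
noncomputable def scaledGamma (l : ℝ) : ℝ :=
  Real.sqrt (l / (2 * Real.pi)) * (laplaceRight l + laplaceLeft l)

/-- The two sides contribute opposite odd terms, so adding them leaves twice the even ones. Only
half of the `2N` terms survive, and these are powers `l^{-k-1/2}`. -/
theorem hasInvPowExpansion_scaledGamma :
    HasInvPowExpansion scaledGamma fun n => (-1) ^ n * stirlingCoeff n := by
  intro N
  have h1 := (isBigO_refl (fun l : ℝ => Real.sqrt (l / (2 * Real.pi))) atTop).mul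
    ((isLaplaceSide_Ioi.isBigO (2 * N)).add (isLaplaceSide_Ioo.isBigO (2 * N)))
  have h2 : (fun l : ℝ => Real.sqrt (l / (2 * Real.pi)) * (1 / l ^ ((((2 * N : ℕ) : ℝ) + 1) / 2)))
      =O[atTop] fun l : ℝ => 1 / l ^ N := by
    refine ((isBigO_refl (fun l : ℝ => 1 / l ^ N) atTop).const_mul_left
      (1 / Real.sqrt (2 * Real.pi))).congr' ?_ EventuallyEq.rfl
    filter_upwards [eventually_gt_atTop (0 : ℝ)] with l hl
    rw [one_div_rpow_half N hl, Real.sqrt_div hl.le]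
    have := Real.sqrt_pos.2 hl
    field_simp
  refine (h1.trans h2).congr' ?_ EventuallyEq.rfl
  filter_upwards [eventually_gt_atTop (0 : ℝ)] with l hl
  rw [scaledGamma, laplaceRight, laplaceLeft, sum_range_two_mul, sum_range_two_mul]
  have hs := Real.sqrt_pos.2 hl
  have hterm : ∀ k : ℕ, (-1) ^ k * stirlingCoeff k * (1 / l ^ k) =
      Real.sqrt (l / (2 * Real.pi)) *
      ((1 ^ (2 * k) * (Real.Gamma ((((2 * k : ℕ) : ℝ) + 1) / 2) * laplaceCoeff (2 * k)) *
          (1 / l ^ ((((2 * k : ℕ) : ℝ) + 1) / 2)) +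
        1 ^ (2 * k + 1) * (Real.Gamma ((((2 * k + 1 : ℕ) : ℝ) + 1) / 2) *
          laplaceCoeff (2 * k + 1)) * (1 / l ^ ((((2 * k + 1 : ℕ) : ℝ) + 1) / 2))) +
      ((-1) ^ (2 * k) * (Real.Gamma ((((2 * k : ℕ) : ℝ) + 1) / 2) * laplaceCoeff (2 * k)) *
          (1 / l ^ ((((2 * k : ℕ) : ℝ) + 1) / 2)) +
        (-1) ^ (2 * k + 1) * (Real.Gamma ((((2 * k + 1 : ℕ) : ℝ) + 1) / 2) *
          laplaceCoeff (2 * k + 1)) * (1 / l ^ ((((2 * k + 1 : ℕ) : ℝ) + 1) / 2)))) := by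
    intro k
    rw [one_div_rpow_half k hl, Real.sqrt_div hl.le, stirlingCoeff, pow_succ (-1 : ℝ) (2 * k),
      pow_mul (-1 : ℝ), neg_one_sq, one_pow, one_pow, one_pow,
      show ((((2 * k : ℕ) : ℝ)) + 1) / 2 = (k : ℝ) + 1 / 2 by push_cast; ring]
    have e1 : ((-1 : ℝ) ^ k) * (-1) ^ k = 1 := by rw [← mul_pow]; norm_num
    have e2 : Real.sqrt (2 / Real.pi) = 2 / Real.sqrt (2 * Real.pi) := by
      rw [Real.sqrt_div (by norm_num), Real.sqrt_mul (by norm_num)]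
      have h3 : Real.sqrt Real.pi ≠ 0 := by positivity
      have h4 : Real.sqrt 2 ≠ 0 := by positivity
      field_simp
      exact Real.sq_sqrt (by norm_num)
    rw [e2]
    have h5 : Real.sqrt (2 * Real.pi) ≠ 0 := by positivity
    have e3 : (-1 : ℝ) ^ k * ((-1) ^ k * (2 / Real.sqrt (2 * Real.pi)) *
        Real.Gamma ((k : ℝ) + 1 / 2) * laplaceCoeff (2 * k)) = 2 / Real.sqrt (2 * Real.pi) *
        Real.Gamma ((k : ℝ) + 1 / 2) * laplaceCoeff (2 * k) := by
      linear_combination (2 / Real.sqrt (2 * Real.pi) *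
        Real.Gamma ((k : ℝ) + 1 / 2) * laplaceCoeff (2 * k)) * e1
    rw [e3]
    field_simp
    ring
  simp only [hterm]
  rw [← Finset.mul_sum, ← mul_sub]
  simp only [Finset.sum_add_distrib]
  ring

theorem hasAsymptoticExpansion_Gamma :
    HasAsymptoticExpansion Real.Gamma
      (fun n l => Real.sqrt (2 * Real.pi) * l ^ (l - 1 / 2) * Real.exp (-l) / l ^ n)
      (fun n => (-1) ^ n * stirlingCoeff n) := by
  intro N
  refine ((isBigO_refl (fun l : ℝ => Real.sqrt (2 * Real.pi) * l ^ (l - 1 / 2) * Real.exp (-l))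
    atTop).mul (hasInvPowExpansion_scaledGamma N)).congr' ?_ ?_
  · filter_upwards [eventually_gt_atTop (0 : ℝ)] with l hl
    rw [Gamma_eq_laplace hl, scaledGamma, mul_sub, Finset.mul_sum]
    congr 1
    · rw [Real.rpow_sub hl, ← Real.sqrt_eq_rpow, Real.sqrt_div hl.le]
      have := Real.sqrt_pos.2 hl
      field_simp
    · refine Finset.sum_congr rfl fun n _ => ?_
      ring
  · filter_upwards with l
    ring

/-- The numerator of `Γ(a, a) / Γ(a) - 1 / 2`, normalized. -/
noncomputable def scaledDiff (a : ℝ) : ℝ := a * ((laplaceRight a - laplaceLeft a) / 2 - 1 / a)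

theorem hasInvPowExpansion_scaledDiff : HasInvPowExpansion scaledDiff
    fun n => (n.factorial : ℝ) * (laplaceCoeff (2 * n + 1) - if n = 0 then 1 else 0) := by
  have key : ∀ N : ℕ, (fun a : ℝ => a * ((laplaceRight a - laplaceLeft a) / 2) -
      ∑ n ∈ Finset.range N, (n.factorial : ℝ) * laplaceCoeff (2 * n + 1) * (1 / a ^ n)) =O[atTop]
      fun a : ℝ => 1 / a ^ N := by
    intro N
    have h1 := (isBigO_refl (fun a : ℝ => a) atTop).mul
      -- An odd number of terms gives an error `O(a^{-N-1})`; the unpaired last term has even index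
      -- `2N` and cancels in the difference.
      (((isLaplaceSide_Ioi.isBigO (2 * N + 1)).sub
        (isLaplaceSide_Ioo.isBigO (2 * N + 1))).const_mul_left (1 / 2))
    refine h1.congr' ?_ ?_
    · filter_upwards [eventually_gt_atTop (0 : ℝ)] with a ha
      rw [laplaceRight, laplaceLeft, Finset.sum_range_succ, Finset.sum_range_succ,
        sum_range_two_mul, sum_range_two_mul]
      have hterm : ∀ k : ℕ, (k.factorial : ℝ) * laplaceCoeff (2 * k + 1) * (1 / a ^ k) =
        a / 2 *
        ((1 ^ (2 * k) * (Real.Gamma ((((2 * k : ℕ) : ℝ) + 1) / 2) * laplaceCoeff (2 * k)) *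
          (1 / a ^ ((((2 * k : ℕ) : ℝ) + 1) / 2)) +
        1 ^ (2 * k + 1) * (Real.Gamma ((((2 * k + 1 : ℕ) : ℝ) + 1) / 2) *
          laplaceCoeff (2 * k + 1)) * (1 / a ^ ((((2 * k + 1 : ℕ) : ℝ) + 1) / 2))) -
        ((-1) ^ (2 * k) * (Real.Gamma ((((2 * k : ℕ) : ℝ) + 1) / 2) * laplaceCoeff (2 * k)) *
          (1 / a ^ ((((2 * k : ℕ) : ℝ) + 1) / 2)) +
        (-1) ^ (2 * k + 1) * (Real.Gamma ((((2 * k + 1 : ℕ) : ℝ) + 1) / 2) *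
          laplaceCoeff (2 * k + 1)) * (1 / a ^ ((((2 * k + 1 : ℕ) : ℝ) + 1) / 2)))) := by
        intro k
        rw [one_div_rpow_odd k, ← Real.Gamma_nat_eq_factorial, pow_succ (-1 : ℝ) (2 * k),
          pow_mul (-1 : ℝ), neg_one_sq, one_pow, one_pow, one_pow,
          show ((((2 * k + 1 : ℕ) : ℝ)) + 1) / 2 = (k : ℝ) + 1 by push_cast; ring]
        rw [pow_succ a k]
        field_simp
        ring
      simp only [hterm]
      rw [← Finset.mul_sum, Finset.sum_sub_distrib, pow_mul (-1 : ℝ), neg_one_sq, one_pow,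
        one_pow]
      ring
    · filter_upwards [eventually_gt_atTop (0 : ℝ)] with a ha
      rw [one_div_rpow_odd]
      field_simp
      ring
  intro N
  have h0 : ∀ᶠ a : ℝ in atTop, scaledDiff a = a * ((laplaceRight a - laplaceLeft a) / 2) - 1 := by
    filter_upwards [eventually_gt_atTop (0 : ℝ)] with a ha
    rw [scaledDiff, mul_sub, mul_one_div_cancel ha.ne']
  cases N with
  | zero =>
    have h1 := (key 0).sub (isBigO_refl (fun _ : ℝ => (1 : ℝ)) atTop |>.congr_right
      fun a : ℝ => show (1 : ℝ) = 1 / a ^ 0 by simp)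
    refine h1.congr' ?_ EventuallyEq.rfl
    filter_upwards [h0] with a ha
    simp [ha]
  | succ N =>
    refine (key (N + 1)).congr' ?_ EventuallyEq.rfl
    filter_upwards [h0] with a ha
    rw [ha, Finset.sum_range_succ', Finset.sum_range_succ']
    simp
    ring

theorem incompleteGamma_div_Gamma {a : ℝ} (ha : 0 < a) :
    incompleteGamma a a / Real.Gamma a - 1 / 2 =
      1 / Real.sqrt (2 * Real.pi * a) * ((scaledGamma a)⁻¹ * scaledDiff a) := by
  have hG := Real.Gamma_pos_of_pos ha
  rw [Gamma_eq_laplace ha] at hG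
  have hpre : 0 < a ^ a * Real.exp (-a) := by positivity
  have hIJ : laplaceRight a + laplaceLeft a ≠ 0 := (pos_of_mul_pos_right hG hpre.le).ne'
  rw [incompleteGamma_eq_laplace ha, Gamma_eq_laplace ha, mul_div_mul_left _ _ hpre.ne',
    scaledGamma, scaledDiff, Real.sqrt_div ha.le, Real.sqrt_mul (by positivity)]
  have h1 := Real.sqrt_pos.2 ha
  have h2 : Real.sqrt (2 * Real.pi) ≠ 0 := by positivity
  have h3 : a = Real.sqrt a * Real.sqrt a := (Real.mul_self_sqrt ha.le).symm
  generalize laplaceRight a = I at *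
  generalize laplaceLeft a = J at *
  generalize Real.sqrt (2 * Real.pi) = p at *
  generalize Real.sqrt a = r at *
  subst h3
  field_simp
  ring

/-- The reciprocal of the Stirling series has coefficients `γ_n`, and the numerator has coefficients
`n! invCoeff(2n+1)`. Their Cauchy product is the sum already obtained for the constant term of the
regular part, so (c) and (d) share one formula. -/
theorem hasInvPowExpansion_quotient :
    HasInvPowExpansion (fun a => (scaledGamma a)⁻¹ * scaledDiff a) fun n =>
      -stirlingCoeff n / 3 + ∑ k ∈ Finset.range n,
        ((n - k).factorial : ℝ) * stirlingCoeff k * laplaceCoeff (2 * (n - k) + 1) := by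
  have hP := isPhaseSeries_taylorSeries
  have hinv : HasInvPowExpansion (fun a => (scaledGamma a)⁻¹) stirlingCoeff := by
    refine hasInvPowExpansion_scaledGamma.inv ?_ fun n => ?_
    · rw [pow_zero, one_mul, stirlingCoeff_eq, hP.stirCoeff_zero, one_mul]
    · have h1 := hP.sum_stirCoeff_mul n
      rw [← Finset.Nat.sum_antidiagonal_swap,
        Finset.Nat.sum_antidiagonal_eq_sum_range_succ_mk, ← h1]
      refine Finset.sum_congr rfl fun k _ => ?_
      simp only [Prod.swap_prod_mk, stirlingCoeff_eq]
      ring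
  have h2 := hinv.mul hasInvPowExpansion_scaledDiff
  convert h2 using 2 with n
  simp only [stirlingCoeff_eq, laplaceCoeff_eq, ← hP.invCoeff_odd]
  rw [← hP.regCoeff_eq, hP.regCoeff_eq_sum, Finset.Nat.sum_antidiagonal_eq_sum_range_succ_mk]

theorem hasAsymptoticExpansion_incompleteGamma :
    HasAsymptoticExpansion (fun a : ℝ => incompleteGamma a a / Real.Gamma a - 1 / 2)
      (fun n a => 1 / Real.sqrt (2 * Real.pi * a) * (1 / a ^ n))
      fun n => -stirlingCoeff n / 3 + ∑ k ∈ Finset.range n,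
        ((n - k).factorial : ℝ) * stirlingCoeff k * laplaceCoeff (2 * (n - k) + 1) := by
  intro N
  refine ((isBigO_refl (fun a : ℝ => 1 / Real.sqrt (2 * Real.pi * a)) atTop).mul
    (hasInvPowExpansion_quotient N)).congr' ?_ EventuallyEq.rfl
  filter_upwards [eventually_gt_atTop (0 : ℝ)] with a ha
  rw [incompleteGamma_div_Gamma ha, mul_sub, Finset.mul_sum]
  congr 1
  refine Finset.sum_congr rfl fun n _ => ?_
  ring

end Gamma

/-! ### The four assertions together. -/

theorem mainTheorem4 :
    -- the `c_n` are the Laplace coefficients of `∫₀^∞ exp (-l (x - log (1 + x))) dx`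
    HasAsymptoticExpansion
      (fun l : ℝ => ∫ x in Set.Ioi (0 : ℝ), Real.exp (-l * phase x))
      (fun n l => 1 / l ^ (((n : ℝ) + 1) / 2))
      (fun n => Real.Gamma (((n : ℝ) + 1) / 2) * laplaceCoeff n) ∧
    -- the `γ_n` are the coefficients of the Stirling expansion of the gamma function
    HasAsymptoticExpansion Real.Gamma
      (fun n l => Real.sqrt (2 * Real.pi) * l ^ (l - 1 / 2) * Real.exp (-l) / l ^ n)
      (fun n => (-1) ^ n * stirlingCoeff n) ∧
    -- the expansion of `Γ(a, a) / Γ(a)` holds exactly for the stated coefficients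
    (∀ C : ℕ → ℝ,
      HasAsymptoticExpansion (fun a : ℝ => incompleteGamma a a / Real.Gamma a - 1 / 2)
        (fun n a => 1 / Real.sqrt (2 * Real.pi * a) * (1 / a ^ n)) C ↔
      ∀ n : ℕ, C n = -stirlingCoeff n / 3 +
        ∑ k ∈ Finset.range n,
          ((n - k).factorial : ℝ) * stirlingCoeff k * laplaceCoeff (2 * (n - k) + 1)) ∧
    -- these coefficients are the limits of Temme's `C_n(η)` as `η → 0`, that is, as `l → 1`
    ∀ n : ℕ, Tendsto (temmeCoeff n) (𝓝[≠] (1 : ℝ))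
      (𝓝 (-stirlingCoeff n / 3 +
        ∑ k ∈ Finset.range n,
          ((n - k).factorial : ℝ) * stirlingCoeff k * laplaceCoeff (2 * (n - k) + 1))) := by
  refine ⟨hasAsymptoticExpansion_laplace, hasAsymptoticExpansion_Gamma, fun C => ⟨fun hC => ?_,
    fun hC => ?_⟩, tendsto_temmeCoeff⟩
  · refine congrFun (HasAsymptoticExpansion.unique
      (φ := fun a => 1 / Real.sqrt (2 * Real.pi * a)) ?_ hC hasAsymptoticExpansion_incompleteGamma)
    filter_upwards [eventually_gt_atTop (0 : ℝ)] with a ha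
    positivity
  · rw [funext hC]
    exact hasAsymptoticExpansion_incompleteGamma
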